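/- Let $d\ge 1$ be an integer, $\nu\ge 0$, $\beta>0$ and $\mu\ge\lambda:=\frac{d+1}{2}+\nu$. For a radial function $\phi:[0,\infty)\to\mathbb R$ let $$\widehat\phi(z)=\frac{z^{1-d/2}}{(2\pi)^{d/2}}\int_0^\infty u^{d/2}J_{d/2-1}(uz)\,\phi(u)\,du,\qquad z>0,$$ be its isotropic spectral density in dimension $d$, where $J_a$ is the Bessel function of the first kind. Let $\mathcal M_{\kappa,\beta}(r)=\frac{2^{1-\kappa}}{\Gamma(\kappa)}\left(\frac r\beta\right)^{\kappa}\mathcal K_\kappa\!\left(\frac r\beta\right)$ for $r>0$, with $\mathcal M_{\kappa,\beta}(0)=1$, be the Matérn correlation function, where $\kappa>0$ and $\mathcal K_\kappa$ is the modified Bessel function of the second kind. For $\delta>0$ let $\mathcal{GW}_{\nu,\mu,\delta}(r)=0$ for $r>\delta$ and, for $0\le r\le\delta$, $$\mathcal{GW}_{\nu,\mu,\delta}(r)=\frac{1}{B(2\nu,\mu+1)}\int_{r/\delta}^1u\left(u^2-(r/\delta)^2\right)^{\nu-1}(1-u)^\mu\,du\quad(\nu>0),\qquad \mathcal{GW}_{0,\mu,\delta}(r)=(1-r/\delta)^\mu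 .$$ Let $\varphi_{\nu,\mu,\beta}=\mathcal{GW}_{\nu,\mu,\delta}$ with $$\delta=\delta_{\nu,\mu,\beta}=\beta\left(\frac{\Gamma(\mu+2\nu+1)}{\Gamma(\mu)}\right)^{1/(1+2\nu)} .$$ Then, for all $z>0$, $$\widehat\varphi_{\nu,\mu,\beta}(z)=\frac{2^{-d}\pi^{-d/2}\,\Gamma(\mu+2\nu+1)\Gamma(2\nu+d)\Gamma(\nu)\,\delta^d}{\Gamma(\nu+\frac d2)\Gamma(\mu+2\nu+d+1)\Gamma(2\nu)}\;{}_1F_2\!\left(\lambda;\lambda+\tfrac\mu2,\lambda+\tfrac{\mu+1}2;-\tfrac{(z\delta)^2}{4}\right)$$ (with $\Gamma(\nu)/\Gamma(2\nu)$ read as its limit $2$ if $\nu=0$) and $$\widehat{\mathcal M}_{\nu+1/2,\beta}(z)=\frac{\Gamma(\nu+\frac{d+1}2)}{\pi^{d/2}\,\Gamma(\nu+\frac12)}\,\frac{\beta^d}{(1+\beta^2z^2)^{\nu+(d+1)/2}} .$$ Moreover the functions $z^{d-1}\widehat\varphi_{\nu,\mu,\beta}(z)$ and $z^{d-1}\widehat{\mathcal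 M}_{\nu+1/2,\beta}(z)$ are integrable on $(0,\infty)$, and $$\int_0^\infty z^{d-1}\,\widehat\varphi_{\nu,\mu,\beta}(z)\,dz=\int_0^\infty z^{d-1}\,\widehat{\mathcal M}_{\nu+1/2,\beta}(z)\,dz=\frac{\Gamma(d/2)}{2\pi^{d/2}} .$$ -/

import Mathlib

/-!
A bounded radial function `φ` with `φ(0) = 1` whose spectral density decays faster than `z^(-d)` is
recovered from it at the origin: the Gaussian `exp(-(t z)² / 4)` is moved across the self-adjoint
Hankel transform, becoming an approximate identity as `t → 0`. Up to the constant
`Γ(d/2) / (2 π^(d/2))` this is the value of both integrals.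

The Matérn function is a mixture of Gaussians over a gamma distribution, so its transform is a gamma
integral. The generalized Wendland function is compactly supported with explicit moments, and
integrating the power series of the Bessel function against it termwise gives the `₁F₂` series.

For the decay of `F(l, r; x) := ₁F₂(l; r/2, (r+1)/2; -x²/4)`, a contiguous relation expresses
`x² F(l+1, r+3; x)` through `F(l, r; x)` and `F(l, r+1; x)`, and an Euler integral raises `r`. This
reduces the claim to `l = 1`, where `F(1, 3; x) = 2 (1 - cos x) / x²`, and to `0 < l < 1`, where
`F(l, 2l; x)` is a normalized Bessel function, bounded by the Sonine–Pólya energy method.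
-/

open Real Set MeasureTheory

noncomputable section

/-- Bessel function of the first kind `J_a` of real order `a`, for arguments `x > 0`. -/
def besselJ (a x : ℝ) : ℝ :=
  ∑' k : ℕ, (-1) ^ k / ((Nat.factorial k : ℝ) * Gamma (k + a + 1)) * (x / 2) ^ (2 * (k : ℝ) + a)

/-- Modified Bessel function of the second kind `K_a` of real order `a`, for arguments `x > 0`. -/
def besselK (a x : ℝ) : ℝ :=
  ∫ t in Ioi (0 : ℝ), exp (-x * cosh t) * cosh (a * t)

/-- The hypergeometric function `₁F₂(a; b, c; x)`. -/
def hypergeometric1F2 (a b c x : ℝ) : ℝ :=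
  ∑' k : ℕ, (ascPochhammer ℝ k).eval a /
    ((ascPochhammer ℝ k).eval b * (ascPochhammer ℝ k).eval c) * (x ^ k / (Nat.factorial k : ℝ))

/-- The isotropic spectral density in dimension `d` of the radial function `φ`, at `z > 0`:
the Hankel form of `(2π)^(-d) ∫ φ(‖x‖) exp(-i⟨x, ξ⟩) dx` over `ℝ^d` at any `ξ` with `‖ξ‖ = z`. -/
def spectralDensity (d : ℕ) (φ : ℝ → ℝ) (z : ℝ) : ℝ :=
  z ^ (1 - (d : ℝ) / 2) / (2 * π) ^ ((d : ℝ) / 2) *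
    ∫ u in Ioi (0 : ℝ), u ^ ((d : ℝ) / 2) * besselJ ((d : ℝ) / 2 - 1) (u * z) * φ u

/-- The Matérn correlation function (with its value `1` at the origin), for `r ≥ 0`. -/
def matern (ν β r : ℝ) : ℝ :=
  if r = 0 then 1
  else 2 ^ (1 - ν) / Gamma ν * (r / β) ^ ν * besselK ν (r / β)

/-- The closed form of the isotropic spectral density of the Matérn correlation function. -/
def maternSpectral (d : ℕ) (ν β z : ℝ) : ℝ :=
  Gamma (ν + d / 2) / (π ^ ((d : ℝ) / 2) * Gamma ν) *
    (β ^ d / (1 + β ^ 2 * z ^ 2) ^ (ν + (d : ℝ) / 2))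

/-- The generalized Wendland correlation function, for `r ≥ 0`; it is the Askey function if
`ν = 0`. -/
def generalizedWendland (ν μ β r : ℝ) : ℝ :=
  if r ≤ β then
    if ν = 0 then (1 - r / β) ^ μ
    else 1 / ProbabilityTheory.beta (2 * ν) (μ + 1) *
      ∫ u in (r / β)..1, u * (u ^ 2 - (r / β) ^ 2) ^ (ν - 1) * (1 - u) ^ μ
  else 0

/-- `λ(d, ν) = (d + 1) / 2 + ν`. -/
def wendlandLambda (d : ℕ) (ν : ℝ) : ℝ := ((d : ℝ) + 1) / 2 + ν

/-- The ratio `Γ(ν) / Γ(2ν)`, with its limit `2` at `ν = 0`. -/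
def gammaRatio (ν : ℝ) : ℝ := if ν = 0 then 2 else Gamma ν / Gamma (2 * ν)

/-- The closed form of the isotropic spectral density of the generalized Wendland correlation
function. -/
def generalizedWendlandSpectral (d : ℕ) (ν μ β z : ℝ) : ℝ :=
  2 ^ (-(d : ℝ)) * π ^ (-(d : ℝ) / 2) * Gamma (μ + 2 * ν + 1) * Gamma (2 * ν + d) * gammaRatio ν /
      (Gamma (ν + d / 2) * Gamma (μ + 2 * ν + d + 1)) * β ^ d *
    hypergeometric1F2 (wendlandLambda d ν) (wendlandLambda d ν + μ / 2)
      (wendlandLambda d ν + (μ + 1) / 2) (-(z * β) ^ 2 / 4)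

/-- The compact support parameter `δ_{ν,μ,β}`. -/
def wendlandDelta (ν μ β : ℝ) : ℝ :=
  β * (Gamma (μ + 2 * ν + 1) / Gamma μ) ^ (1 / (1 + 2 * ν))

/-- The reparametrized generalized Wendland correlation function `φ_{ν,μ,β}`. -/
def reparamWendland (ν μ β r : ℝ) : ℝ :=
  generalizedWendland ν μ (wendlandDelta ν μ β) r

end

open Filter Topology

theorem Gamma_natCast_add {x : ℝ} (hx : 0 < x) (k : ℕ) :
    Gamma (k + x) = (ascPochhammer ℝ k).eval x * Gamma x := by
  induction k with
  | zero => simp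
  | succ k ih =>
    rw [Nat.cast_succ, add_right_comm, Real.Gamma_add_one (by positivity), ih,
      ascPochhammer_succ_eval]
    ring

theorem ascPochhammer_eval_two_mul (x : ℝ) (k : ℕ) :
    (ascPochhammer ℝ (2 * k)).eval x =
      4 ^ k * ((ascPochhammer ℝ k).eval (x / 2) * (ascPochhammer ℝ k).eval ((x + 1) / 2)) := by
  induction k with
  | zero => simp
  | succ k ih =>
    rw [mul_add_one, ascPochhammer_succ_eval, ascPochhammer_succ_eval, ih,
      ascPochhammer_succ_eval, ascPochhammer_succ_eval]
    push_cast
    ring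

theorem min_one_le_ascPochhammer_eval {x : ℝ} (hx : 0 < x) (k : ℕ) :
    min 1 x ≤ (ascPochhammer ℝ k).eval x := by
  rcases k with _ | k
  · simp
  · induction k with
    | zero => simp
    | succ k ih =>
      rw [ascPochhammer_succ_eval]
      refine ih.trans (le_mul_of_one_le_right (ascPochhammer_pos _ _ hx).le ?_)
      push_cast
      linarith [(Nat.cast_nonneg k : (0 : ℝ) ≤ k)]

/-- The truncated power `x₊ ^ p`, which vanishes for `x ≤ 0` whatever `p` is. -/
noncomputable def truncPow (p x : ℝ) : ℝ := if 0 < x then x ^ p else 0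

theorem truncPow_of_pos {x : ℝ} (p : ℝ) (hx : 0 < x) : truncPow p x = x ^ p := if_pos hx

theorem truncPow_of_nonpos {x : ℝ} (p : ℝ) (hx : x ≤ 0) : truncPow p x = 0 := if_neg hx.not_gt

theorem truncPow_nonneg (p x : ℝ) : 0 ≤ truncPow p x := by
  rw [truncPow]; split_ifs <;> positivity

theorem truncPow_mul {c : ℝ} (hc : 0 < c) (p x : ℝ) :
    truncPow p (c * x) = c ^ p * truncPow p x := by
  rcases le_or_gt x 0 with hx | hx
  · rw [truncPow_of_nonpos p hx, truncPow_of_nonpos p (by nlinarith), mul_zero]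
  · rw [truncPow_of_pos p hx, truncPow_of_pos p (mul_pos hc hx), mul_rpow hc.le hx.le]

theorem measurable_truncPow (p : ℝ) : Measurable (truncPow p) :=
  Measurable.ite measurableSet_Ioi (by fun_prop) measurable_const

theorem truncPow_eq_max_rpow {p : ℝ} (hp : 0 < p) (x : ℝ) : truncPow p x = max x 0 ^ p := by
  rcases le_or_gt x 0 with hx | hx
  · rw [truncPow_of_nonpos p hx, max_eq_right hx, zero_rpow hp.ne']
  · rw [truncPow_of_pos p hx, max_eq_left hx.le]

theorem continuous_truncPow {p : ℝ} (hp : 0 < p) : Continuous (truncPow p) := by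
  rw [funext (truncPow_eq_max_rpow hp)]
  exact (continuous_id.max continuous_const).rpow_const fun _ => .inr hp.le

theorem monotone_truncPow {p : ℝ} (hp : 0 < p) : Monotone (truncPow p) := fun x y hxy => by
  rw [truncPow_eq_max_rpow hp, truncPow_eq_max_rpow hp]
  gcongr

/-- `f` has moment `m` of order `s - 1` on the half-line, the integral being absolutely convergent:
the counterpart of `HasMellin` for real exponents. -/
def HasMoment (f : ℝ → ℝ) (s m : ℝ) : Prop :=
  IntegrableOn (fun u => u ^ (s - 1) * f u) (Ioi 0) ∧ ∫ u in Ioi 0, u ^ (s - 1) * f u = m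

namespace HasMoment

variable {f g : ℝ → ℝ} {s m : ℝ}

theorem congr (hf : HasMoment f s m) (hfg : EqOn f g (Ioi 0)) : HasMoment g s m := by
  have h : EqOn (fun u => u ^ (s - 1) * f u) (fun u => u ^ (s - 1) * g u) (Ioi 0) :=
    fun u hu => congrArg (u ^ (s - 1) * ·) (hfg hu)
  exact ⟨hf.1.congr_fun h measurableSet_Ioi,
    (setIntegral_congr_fun measurableSet_Ioi h).symm.trans hf.2⟩

theorem const_mul (hf : HasMoment f s m) (c : ℝ) : HasMoment (fun u => c * f u) s (c * m) := by
  simp only [HasMoment, mul_left_comm _ c, integral_const_mul, hf.2, and_true]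
  exact hf.1.const_mul c

theorem comp_div (hf : HasMoment f s m) {δ : ℝ} (hδ : 0 < δ) :
    HasMoment (fun u => f (u / δ)) s (δ ^ s * m) := by
  set g : ℝ → ℝ := fun v => v ^ (s - 1) * f v with hg
  have h : EqOn (fun u => u ^ (s - 1) * f (u / δ)) (fun u => δ ^ (s - 1) * g (δ⁻¹ * u)) (Ioi 0) :=
    fun u hu => by
      have hu : 0 < u := hu
      simp only [hg, inv_mul_eq_div, div_rpow hu.le hδ.le]
      field_simp
  refine ⟨(integrableOn_congr_fun h measurableSet_Ioi).mpr (Integrable.const_mul ?_ _), ?_⟩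
  · exact (integrableOn_Ioi_comp_mul_left_iff g 0 (inv_pos.mpr hδ)).mpr (by simpa using hf.1)
  · rw [setIntegral_congr_fun measurableSet_Ioi h, integral_const_mul,
      integral_comp_mul_left_Ioi g _ (inv_pos.mpr hδ), mul_zero, hf.2, inv_inv, smul_eq_mul,
      ← mul_assoc, ← rpow_add_one hδ.ne', sub_add_cancel]

theorem comp_sq (hf : HasMoment f (s / 2) m) : HasMoment (fun u => f (u ^ 2)) s (m / 2) := by
  set g : ℝ → ℝ := fun v => v ^ (s / 2 - 1) * f v with hg
  have h : EqOn (fun u => (|2| * u ^ ((2 : ℝ) - 1)) • g (u ^ (2 : ℝ)))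
      (fun u => 2 * (u ^ (s - 1) * f (u ^ 2))) (Ioi 0) := fun u hu => by
    have hu : 0 < u := hu
    have hpow : u ^ (s - 1) = u ^ ((2 : ℝ) - 1) * u ^ (2 * (s / 2 - 1)) := by
      rw [← rpow_add hu]; congr 1; ring
    simp only [hg, abs_two, smul_eq_mul, hpow, rpow_mul hu.le, rpow_two]
    ring
  constructor
  · have := (integrableOn_Ioi_comp_rpow_iff g two_ne_zero).mpr hf.1
    rw [integrableOn_congr_fun h measurableSet_Ioi] at this
    exact (integrable_const_mul_iff (isUnit_iff_ne_zero.mpr two_ne_zero) _).mp this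
  · have := integral_comp_rpow_Ioi g two_ne_zero
    rw [hf.2, setIntegral_congr_fun measurableSet_Ioi h, integral_const_mul] at this
    linarith

theorem integrable_prod {k : ℝ → ℝ → ℝ} {m : ℝ → ℝ} (hk : Measurable (Function.uncurry k))
    (hk0 : ∀ r, 0 < r → ∀ u, 0 < u → 0 ≤ k r u)
    (hm : ∀ u, 0 < u → HasMoment (fun r => k r u) s (m u)) (hmi : IntegrableOn m (Ioi 0)) :
    Integrable (fun q : ℝ × ℝ => q.1 ^ (s - 1) * k q.1 q.2)
      ((volume.restrict (Ioi 0)).prod (volume.restrict (Ioi 0))) := by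
  refine (integrable_prod_iff' ?_).mpr
    ⟨(ae_restrict_mem measurableSet_Ioi).mono fun u hu => (hm u hu).1, ?_⟩
  · exact ((measurable_fst.pow_const _).mul hk).aestronglyMeasurable
  · refine hmi.congr_fun (fun u hu => ?_) measurableSet_Ioi
    rw [← (hm u hu).2]
    refine setIntegral_congr_fun measurableSet_Ioi fun r (hr : 0 < r) => ?_
    exact (norm_of_nonneg (mul_nonneg (rpow_nonneg hr.le _) (hk0 r hr u hu))).symm

theorem integral {k : ℝ → ℝ → ℝ} {m : ℝ → ℝ} (hk : Measurable (Function.uncurry k))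
    (hk0 : ∀ r, 0 < r → ∀ u, 0 < u → 0 ≤ k r u)
    (hm : ∀ u, 0 < u → HasMoment (fun r => k r u) s (m u)) (hmi : IntegrableOn m (Ioi 0)) :
    HasMoment (fun r => ∫ u in Ioi 0, k r u) s (∫ u in Ioi 0, m u) := by
  have h := integrable_prod hk hk0 hm hmi
  simp only [HasMoment, ← integral_const_mul]
  refine ⟨h.integral_prod_left, ?_⟩
  rw [integral_integral_swap h]
  exact setIntegral_congr_fun measurableSet_Ioi fun u hu => (hm u hu).2

theorem hasSum_integral_tsum {M : ℕ → ℝ} (hf : ∀ u, 0 < u → 0 ≤ f u)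
    (hM : ∀ k : ℕ, HasMoment f (s + 2 * k) (M k)) {c : ℕ → ℝ}
    (hc : Summable fun k => |c k| * M k) :
    HasSum (fun k => c k * M k)
      (∫ u in Ioi 0, u ^ (s - 1) * (∑' k, c k * u ^ (2 * k)) * f u) := by
  have hterm : ∀ k, EqOn (fun u => c k * (u ^ (s + 2 * k - 1) * f u))
      (fun u => u ^ (s - 1) * (c k * u ^ (2 * k)) * f u) (Ioi 0) := fun k u hu => by
    have hpow : u ^ (s + 2 * k - 1) = u ^ (s - 1) * u ^ (2 * k) := by
      rw [← rpow_natCast, ← rpow_add hu]; congr 1; push_cast; ring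
    simp only [hpow]
    ring
  have key := hasSum_integral_of_summable_integral_norm (μ := volume.restrict (Ioi (0 : ℝ)))
    (F := fun k u => c k * (u ^ (s + 2 * k - 1) * f u)) (fun k => (hM k).1.const_mul _) ?_
  · simp only [integral_const_mul, (hM _).2] at key
    refine (congrArg (HasSum _) (setIntegral_congr_fun measurableSet_Ioi fun u hu => ?_)).mp key
    simp only [← tsum_mul_left, ← tsum_mul_right]
    exact tsum_congr fun k => hterm k hu
  · refine hc.congr fun k => ?_
    rw [← (hM k).2, ← integral_const_mul]
    refine setIntegral_congr_fun measurableSet_Ioi fun u (hu : 0 < u) => ?_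
    simp only [norm_mul, norm_eq_abs, abs_of_nonneg (hf u hu), abs_of_nonneg (rpow_nonneg hu.le _)]

end HasMoment

theorem hasMoment_exp_neg_mul_sq {s p : ℝ} (hs : 0 < s) (hp : 0 < p) :
    HasMoment (fun u => exp (-p * u ^ 2)) s (p ^ (-(s / 2)) * Gamma (s / 2) / 2) := by
  refine ⟨integrableOn_rpow_mul_exp_neg_mul_sq hp (by linarith), ?_⟩
  have h := integral_rpow_mul_exp_neg_mul_rpow (p := 2) (q := s - 1) (b := p) (by norm_num)
    (by linarith) hp
  simp only [rpow_two, sub_add_cancel, neg_div] at h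
  rw [h]
  ring

theorem hasMoment_truncPow_one_sub {s t : ℝ} (hs : 0 < s) (ht : 0 < t) :
    HasMoment (fun u => truncPow (t - 1) (1 - u)) s (ProbabilityTheory.beta s t) := by
  have hB : 0 < ProbabilityTheory.beta s t := ProbabilityTheory.beta_pos hs ht
  have hPDF : ∫ u, ProbabilityTheory.betaPDFReal s t u = 1 := by
    rw [integral_eq_lintegral_of_nonneg_ae (.of_forall fun u => ?_) (by fun_prop)]
    · exact (congrArg ENNReal.toReal (ProbabilityTheory.lintegral_betaPDF_eq_one hs ht)).trans
        ENNReal.toReal_one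
    · by_cases hu : 0 < u ∧ u < 1
      · exact (ProbabilityTheory.betaPDFReal_pos hu.1 hu.2 hs ht).le
      · simp [ProbabilityTheory.betaPDFReal, hu]
  have h : (Ioi 0).indicator (fun u => u ^ (s - 1) * truncPow (t - 1) (1 - u)) =
      fun u => ProbabilityTheory.beta s t * ProbabilityTheory.betaPDFReal s t u := by
    ext u
    simp only [indicator, mem_Ioi, truncPow, sub_pos, ProbabilityTheory.betaPDFReal, ite_and]
    split_ifs
    · field_simp
    all_goals simp only [mul_zero]
  rw [HasMoment, ← integrable_indicator_iff measurableSet_Ioi,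
    ← integral_indicator measurableSet_Ioi, h, integral_const_mul, hPDF, mul_one]
  exact ⟨(integrable_of_integral_eq_one hPDF).const_mul _, rfl⟩

/-- `f(x) = O(x ^ (-e))` uniformly on the whole half-line `x > 0`. -/
def HasPowerDecay (f : ℝ → ℝ) (e : ℝ) : Prop :=
  ∃ C, ∀ x, 0 < x → |f x| ≤ C * x ^ (-e)

namespace HasPowerDecay

variable {f g : ℝ → ℝ} {e : ℝ}

theorem congr (hf : HasPowerDecay f e) (hfg : EqOn f g (Ioi 0)) : HasPowerDecay g e := by
  obtain ⟨C, hC⟩ := hf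
  exact ⟨C, fun x hx => hfg hx ▸ hC x hx⟩

theorem const_mul (hf : HasPowerDecay f e) (c : ℝ) : HasPowerDecay (fun x => c * f x) e := by
  obtain ⟨C, hC⟩ := hf
  refine ⟨|c| * C, fun x hx => ?_⟩
  rw [abs_mul, mul_assoc]
  exact mul_le_mul_of_nonneg_left (hC x hx) (abs_nonneg c)

theorem comp_mul_right (hf : HasPowerDecay f e) {δ : ℝ} (hδ : 0 < δ) :
    HasPowerDecay (fun z => f (z * δ)) e := by
  obtain ⟨C, hC⟩ := hf
  refine ⟨C * δ ^ (-e), fun z hz => (hC (z * δ) (mul_pos hz hδ)).trans_eq ?_⟩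
  rw [mul_rpow hz.le hδ.le]
  ring

end HasPowerDecay

theorem Gamma_natCast_add_pos {a : ℝ} (ha : -1 < a) (k : ℕ) : 0 < Gamma (k + a + 1) :=
  Real.Gamma_pos_of_pos (by linarith [(Nat.cast_nonneg k : (0 : ℝ) ≤ k)])

theorem summable_pow_div_factorial_mul_Gamma {a : ℝ} (ha : -1 < a) (y : ℝ) :
    Summable fun k : ℕ => y ^ k / ((Nat.factorial k : ℝ) * Gamma (k + a + 1)) := by
  have ha1 : 0 < a + 1 := by linarith
  have : 0 < min 1 (a + 1) * Gamma (a + 1) :=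
    mul_pos (lt_min one_pos ha1) (Real.Gamma_pos_of_pos ha1)
  refine Summable.of_norm_bounded
    (g := fun k : ℕ => (min 1 (a + 1) * Gamma (a + 1))⁻¹ * (|y| ^ k / (Nat.factorial k : ℝ)))
    ((Real.summable_pow_div_factorial |y|).mul_left _) fun k => ?_
  have hGamma : min 1 (a + 1) * Gamma (a + 1) ≤ Gamma (k + a + 1) := by
    rw [add_assoc, Gamma_natCast_add ha1]
    gcongr
    exact min_one_le_ascPochhammer_eval ha1 k
  rw [norm_div, norm_pow, norm_mul, Real.norm_natCast, norm_eq_abs,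
    norm_of_nonneg (Gamma_natCast_add_pos ha k).le, mul_comm (Nat.factorial k : ℝ), ← div_div,
    div_right_comm, div_eq_inv_mul _ (Gamma _)]
  gcongr

/-- The even entire function `(x / 2) ^ (-a) * besselJ a x`. -/
noncomputable def besselSeries (a x : ℝ) : ℝ :=
  ∑' k : ℕ, (-1) ^ k / ((Nat.factorial k : ℝ) * Gamma (k + a + 1)) * (x / 2) ^ (2 * k)

theorem besselJ_eq_rpow_mul_besselSeries (a : ℝ) {x : ℝ} (hx : 0 < x) :
    besselJ a x = (x / 2) ^ a * besselSeries a x := by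
  rw [besselJ, besselSeries, ← tsum_mul_left]
  refine tsum_congr fun k => ?_
  rw [rpow_add (by positivity), ← rpow_natCast _ (2 * k)]
  push_cast
  ring

theorem summable_besselSeries {a : ℝ} (ha : -1 < a) (x : ℝ) :
    Summable fun k : ℕ =>
      (-1) ^ k / ((Nat.factorial k : ℝ) * Gamma (k + a + 1)) * (x / 2) ^ (2 * k) :=
  (summable_pow_div_factorial_mul_Gamma ha (-(x / 2) ^ 2)).congr fun k => by
    rw [neg_pow ((x / 2) ^ 2), pow_mul, mul_div_right_comm]

theorem besselSeries_zero (a : ℝ) : besselSeries a 0 = 1 / Gamma (a + 1) := by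
  rw [besselSeries, tsum_eq_single 0 fun k hk => by simp [hk]]
  simp

theorem besselSeries_neg (a x : ℝ) : besselSeries a (-x) = besselSeries a x :=
  tsum_congr fun k => by rw [neg_div, (even_two_mul k).neg_pow]

theorem hasDerivAt_besselSeries {a : ℝ} (ha : -1 < a) (x : ℝ) :
    HasDerivAt (besselSeries a) (-(x / 2) * besselSeries (a + 1) x) x := by
  set c : ℝ → ℕ → ℝ := fun a k => (-1) ^ k / ((Nat.factorial k : ℝ) * Gamma (k + a + 1)) with hc
  set g' : ℕ → ℝ → ℝ := fun k y => c a k * (((2 * k : ℕ) : ℝ) * (y / 2) ^ (2 * k - 1) * (1 / 2))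
    with hg'
  have hsucc : ∀ k y, g' (k + 1) y = -(y / 2) * (c (a + 1) k * (y / 2) ^ (2 * k)) := fun k y => by
    have hG : Gamma (k + (a + 1) + 1) ≠ 0 := (Gamma_natCast_add_pos (by linarith) k).ne'
    simp only [hg', hc, Nat.factorial_succ, show 2 * (k + 1) - 1 = 2 * k + 1 by omega]
    push_cast
    rw [show (k : ℝ) + 1 + a + 1 = k + (a + 1) + 1 by ring]
    field_simp
    ring
  have hsum : ∀ y, Summable fun k => g' k y := fun y => (summable_nat_add_iff 1).mp
    (((summable_besselSeries (a := a + 1) (by linarith) y).mul_left _).congr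
      fun k => (hsucc k y).symm)
  have hderiv := hasDerivAt_tsum_of_isPreconnected (g := fun k y => c a k * (y / 2) ^ (2 * k))
    (g' := g') (hsum (|x| + 1)).norm Metric.isOpen_ball
    (convex_ball (0 : ℝ) (|x| + 1)).isPreconnected
    (fun k y _ => (((hasDerivAt_id y).div_const 2).pow (2 * k)).const_mul (c a k)) ?_
    (Metric.mem_ball_self (by positivity)) (summable_besselSeries ha 0)
    (show x ∈ Metric.ball (0 : ℝ) (|x| + 1) by simp)
  · rw [(hsum x).tsum_eq_zero_add, tsum_congr (hsucc · x), tsum_mul_left] at hderiv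
    exact hderiv.congr_deriv (by simp [hg', besselSeries, hc])
  · intro k y hy
    have hy : |y| ≤ |(|x| + 1)| := by
      rw [mem_ball_zero_iff, norm_eq_abs] at hy
      exact hy.le.trans (le_abs_self _)
    simp only [hg', norm_mul, norm_pow, norm_div, norm_eq_abs]
    gcongr

theorem continuous_besselSeries {a : ℝ} (ha : -1 < a) : Continuous (besselSeries a) :=
  continuous_iff_continuousAt.mpr fun x => (hasDerivAt_besselSeries ha x).continuousAt

theorem besselSeries_recurrence {a : ℝ} (ha : -1 < a) (x : ℝ) :
    (a + 1) * besselSeries (a + 1) x =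
      besselSeries a x + (x / 2) ^ 2 * besselSeries (a + 2) x := by
  have h0 := summable_besselSeries ha x
  have h1 := (summable_besselSeries (a := a + 1) (by linarith) x).mul_left (a + 1)
  rw [← sub_eq_iff_eq_add', besselSeries, besselSeries, besselSeries, ← tsum_mul_left,
    ← h1.tsum_sub h0, (h1.sub h0).tsum_eq_zero_add, ← tsum_mul_left]
  have hG : 0 < Gamma (a + 1) := by simpa using Gamma_natCast_add_pos ha 0
  have hzero : (a + 1) * (1 / Gamma (a + 1 + 1)) = 1 / Gamma (a + 1) := by
    rw [Real.Gamma_add_one (by linarith)]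
    have : a + 1 ≠ 0 := by linarith
    field_simp
  simp only [Nat.factorial_zero, Nat.cast_zero, pow_zero, Nat.cast_one, zero_add, one_mul, mul_zero,
    mul_one, hzero, sub_self]
  refine tsum_congr fun k => ?_
  have hk : (k : ℝ) + a + 2 ≠ 0 := by
    linarith [(Nat.cast_nonneg k : (0 : ℝ) ≤ k)]
  have hGk : Gamma (k + a + 2) ≠ 0 := by
    simpa [add_assoc, one_add_one_eq_two] using
      (Gamma_natCast_add_pos (a := a + 1) (by linarith) k).ne'
  have hrec : Gamma (k + a + 3) = (k + a + 2) * Gamma (k + a + 2) := by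
    rw [← Real.Gamma_add_one hk]; congr 1; ring
  push_cast [Nat.factorial_succ]
  rw [show (k : ℝ) + 1 + (a + 1) + 1 = k + a + 3 by ring,
    show (k : ℝ) + 1 + a + 1 = k + a + 2 by ring, show (k : ℝ) + (a + 2) + 1 = k + a + 3 by ring,
    hrec]
  field_simp
  ring

theorem hasDerivAt_deriv_besselSeries {a : ℝ} (ha : -1 < a) (x : ℝ) :
    HasDerivAt (fun x => -(x / 2) * besselSeries (a + 1) x)
      ((a + 1 / 2) * besselSeries (a + 1) x - besselSeries a x) x := by
  have h := ((hasDerivAt_id x).div_const 2).neg.mul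
    (hasDerivAt_besselSeries (a := a + 1) (by linarith) x)
  refine h.congr_deriv ?_
  have hrec := besselSeries_recurrence ha x
  rw [show a + 1 + 1 = a + 2 by ring]
  simp only [id, Pi.neg_apply]
  linear_combination -hrec

/-- The energy `f ^ 2 + f' ^ 2` of `f = besselSeries a` decreases along the half-line. -/
theorem abs_besselSeries_le {a : ℝ} (ha : -1 / 2 ≤ a) (x : ℝ) :
    |besselSeries a x| ≤ 1 / Gamma (a + 1) := by
  wlog hx : 0 ≤ x generalizing x
  · rw [← besselSeries_neg]
    exact this (-x) (by linarith)
  have ha1 : -1 < a := by linarith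
  set energy : ℝ → ℝ := fun x => besselSeries a x ^ 2 + (-(x / 2) * besselSeries (a + 1) x) ^ 2
    with henergy
  have hderiv : ∀ x, HasDerivAt energy (-((a + 1 / 2) * x * besselSeries (a + 1) x ^ 2)) x :=
    fun x => (((hasDerivAt_besselSeries ha1 x).pow 2).add
      ((hasDerivAt_deriv_besselSeries ha1 x).pow 2)).congr_deriv (by ring)
  have hanti : AntitoneOn energy (Ici 0) := by
    refine antitoneOn_of_hasDerivWithinAt_nonpos (convex_Ici 0)
      (fun x _ => (hderiv x).continuousAt.continuousWithinAt)
      (fun x _ => (hderiv x).hasDerivWithinAt) fun x hx => ?_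
    rw [interior_Ici] at hx
    have : 0 ≤ a + 1 / 2 := by linarith
    have : 0 < x := hx
    exact neg_nonpos.mpr (by positivity)
  refine abs_le_of_sq_le_sq ?_ (one_div_pos.mpr (Real.Gamma_pos_of_pos (by linarith))).le
  have h0 : energy 0 = (1 / Gamma (a + 1)) ^ 2 := by simp [henergy, besselSeries_zero]
  rw [← h0]
  exact (le_add_of_nonneg_right (sq_nonneg _)).trans (hanti self_mem_Ici hx hx)

theorem hasDerivAt_rpow_mul_besselSeries {a x : ℝ} (ha : -1 < a) (hx : 0 < x) (p : ℝ) :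
    HasDerivAt (fun x => x ^ p * besselSeries a x)
      (x ^ p * (p / x * besselSeries a x + -(x / 2) * besselSeries (a + 1) x)) x := by
  refine ((hasDerivAt_rpow_const (p := p) (.inl hx.ne')).mul
    (hasDerivAt_besselSeries ha x)).congr_deriv ?_
  rw [rpow_sub_one hx.ne']
  ring

/-- Liouville normal form of Bessel's equation: `w = x ^ (a + 1 / 2) * besselSeries a x` satisfies
`w'' = -(1 + (1 / 4 - a ^ 2) / x ^ 2) * w`. -/
theorem hasDerivAt_deriv_rpow_mul_besselSeries {a x : ℝ} (ha : -1 < a) (hx : 0 < x) :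
    HasDerivAt (fun x => x ^ (a + 1 / 2) *
        ((a + 1 / 2) / x * besselSeries a x + -(x / 2) * besselSeries (a + 1) x))
      (-(1 + (1 / 4 - a ^ 2) / x ^ 2) * (x ^ (a + 1 / 2) * besselSeries a x)) x := by
  have hpow := hasDerivAt_rpow_const (p := a + 1 / 2) (.inl hx.ne')
  have hdiv := ((hasDerivAt_const x (a + 1 / 2)).div (hasDerivAt_id x) hx.ne').mul
    (hasDerivAt_besselSeries ha x)
  refine (hpow.mul (hdiv.add (hasDerivAt_deriv_besselSeries ha x))).congr_deriv ?_
  simp only [Pi.add_apply, Pi.mul_apply, Pi.div_apply, id]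
  rw [rpow_sub_one hx.ne']
  field_simp
  ring

/-- The energy `w' ^ 2 + (1 + q / x ^ 2) * w ^ 2` decreases along the half-line. -/
theorem exists_abs_le_of_hasDerivAt_liouville {w w' : ℝ → ℝ} {q : ℝ} (hq : 0 ≤ q)
    (hw : ∀ x, 0 < x → HasDerivAt w (w' x) x)
    (hw' : ∀ x, 0 < x → HasDerivAt w' (-(1 + q / x ^ 2) * w x) x) :
    ∃ C, ∀ x, 1 ≤ x → |w x| ≤ C := by
  set energy : ℝ → ℝ := fun x => w' x ^ 2 + (1 + q / x ^ 2) * w x ^ 2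
  have hderiv : ∀ x, 0 < x → HasDerivAt energy (-(2 * q / x ^ 3 * w x ^ 2)) x := fun x hx => by
    have hcoef := ((hasDerivAt_const x q).div (hasDerivAt_pow 2 x)
      (pow_ne_zero 2 hx.ne')).const_add 1
    refine (((hw' x hx).pow 2).add (hcoef.mul ((hw x hx).pow 2))).congr_deriv ?_
    simp only [Pi.pow_apply, Pi.div_apply]
    field_simp
    ring
  have hpos : ∀ x ∈ Ici (1 : ℝ), 0 < x := fun x hx => one_pos.trans_le hx
  have hanti : AntitoneOn energy (Ici 1) := by
    refine antitoneOn_of_hasDerivWithinAt_nonpos (convex_Ici 1)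
      (fun x hx => (hderiv x (hpos x hx)).continuousAt.continuousWithinAt)
      (fun x hx => (hderiv x (hpos x (interior_subset hx))).hasDerivWithinAt) fun x hx => ?_
    have := hpos x (interior_subset hx)
    exact neg_nonpos.mpr (by positivity)
  refine ⟨√(energy 1), fun x hx => abs_le_sqrt ?_⟩
  refine (?_ : w x ^ 2 ≤ energy x).trans (hanti self_mem_Ici hx hx)
  have : 0 ≤ q / x ^ 2 := by positivity
  nlinarith [sq_nonneg (w' x), sq_nonneg (w x)]

theorem hasPowerDecay_besselSeries {a : ℝ} (ha : |a| ≤ 1 / 2) :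
    HasPowerDecay (besselSeries a) (a + 1 / 2) := by
  obtain ⟨ha', ha''⟩ := abs_le.mp ha
  have ha1 : -1 < a := by linarith
  obtain ⟨C, hC⟩ := exists_abs_le_of_hasDerivAt_liouville (q := 1 / 4 - a ^ 2) (by nlinarith)
    (fun x hx => hasDerivAt_rpow_mul_besselSeries ha1 hx (a + 1 / 2))
    (fun x hx => hasDerivAt_deriv_rpow_mul_besselSeries ha1 hx)
  refine ⟨max (1 / Gamma (a + 1)) C, fun x hx => ?_⟩
  rcases le_total x 1 with hx1 | hx1
  · refine (abs_besselSeries_le (by linarith) x).trans ((le_max_left _ C).trans ?_)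
    refine le_mul_of_one_le_right ?_ (one_le_rpow_of_pos_of_le_one_of_nonpos hx hx1 (by linarith))
    exact (abs_nonneg _).trans ((abs_besselSeries_le (by linarith) 0).trans (le_max_left _ C))
  · have hwx := (hC x hx1).trans (le_max_right (1 / Gamma (a + 1)) _)
    rw [abs_mul, abs_of_pos (rpow_pos_of_pos hx _)] at hwx
    rwa [rpow_neg hx.le, ← div_eq_mul_inv, le_div_iff₀ (by positivity), mul_comm]

/-- The Hankel form of the Fourier transform of the radial function `φ` in the possibly fractional
dimension `s`, without the normalizing constant of `spectralDensity`. -/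
noncomputable def hankelTransform (s : ℝ) (φ : ℝ → ℝ) (z : ℝ) : ℝ :=
  ∫ u in Ioi 0, u ^ (s - 1) * besselSeries (s / 2 - 1) (u * z) * φ u

theorem hankelTransform_congr {φ ψ : ℝ → ℝ} (h : EqOn φ ψ (Ioi 0)) (s z : ℝ) :
    hankelTransform s φ z = hankelTransform s ψ z :=
  setIntegral_congr_fun measurableSet_Ioi fun u hu => by simp only [h hu]

theorem spectralDensity_eq_hankelTransform (d : ℕ) (φ : ℝ → ℝ) {z : ℝ} (hz : 0 < z) :
    spectralDensity d φ z =
      2 ^ (1 - (d : ℝ)) * π ^ (-(d : ℝ) / 2) * hankelTransform d φ z := by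
  have hconst : z ^ (1 - (d : ℝ) / 2) / (2 * π) ^ ((d : ℝ) / 2) * (z / 2) ^ ((d : ℝ) / 2 - 1) =
      2 ^ (1 - (d : ℝ)) * π ^ (-(d : ℝ) / 2) := by
    rw [div_rpow hz.le zero_le_two, mul_rpow zero_le_two pi_pos.le, div_mul_div_comm,
      ← rpow_add hz, show 1 - (d : ℝ) / 2 + ((d : ℝ) / 2 - 1) = 0 by ring, rpow_zero,
      mul_right_comm, ← rpow_add two_pos, neg_div, rpow_neg pi_pos.le,
      show (d : ℝ) / 2 + ((d : ℝ) / 2 - 1) = -(1 - (d : ℝ)) by ring, rpow_neg zero_le_two]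
    have : (0 : ℝ) < 2 ^ (1 - (d : ℝ)) := by positivity
    field_simp
  rw [spectralDensity, ← hconst, mul_assoc, hankelTransform,
    ← integral_const_mul ((z / 2) ^ ((d : ℝ) / 2 - 1))]
  congr 1
  refine setIntegral_congr_fun measurableSet_Ioi fun u (hu : 0 < u) => ?_
  rw [besselJ_eq_rpow_mul_besselSeries _ (by positivity), mul_div_assoc,
    mul_rpow hu.le (by positivity), show (d : ℝ) - 1 = d / 2 + (d / 2 - 1) by ring, rpow_add hu]
  ring

section HankelTransform

variable {s : ℝ} {φ ψ : ℝ → ℝ}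

theorem abs_besselSeries_mul_le (hs : 1 ≤ s) (u z : ℝ) :
    |besselSeries (s / 2 - 1) (u * z)| ≤ 1 / Gamma (s / 2) := by
  simpa using abs_besselSeries_le (show -1 / 2 ≤ s / 2 - 1 by linarith) (u * z)

theorem measurable_hankelTransform (hs : 0 < s) (hφ : Measurable ((Ioi 0).indicator φ)) :
    Measurable (hankelTransform s φ) := by
  have hbessel := (continuous_besselSeries (a := s / 2 - 1) (by linarith)).measurable
  have hkernel : Measurable fun q : ℝ × ℝ =>
      q.2 ^ (s - 1) * besselSeries (s / 2 - 1) (q.2 * q.1) * (Ioi 0).indicator φ q.2 := by fun_prop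
  rw [← funext (hankelTransform_congr (eqOn_indicator (s := Ioi 0) (f := φ)) s)]
  exact hkernel.stronglyMeasurable.integral_prod_right'.measurable

theorem abs_hankelTransform_le (hs : 1 ≤ s)
    (hφ : IntegrableOn (fun u => u ^ (s - 1) * φ u) (Ioi 0)) (z : ℝ) :
    |hankelTransform s φ z| ≤ 1 / Gamma (s / 2) * ∫ u in Ioi 0, |u ^ (s - 1) * φ u| := by
  rw [← integral_const_mul (1 / Gamma (s / 2)), ← norm_eq_abs, hankelTransform]
  refine norm_integral_le_of_norm_le (hφ.abs.const_mul _) (.of_forall fun u => ?_)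
  rw [mul_right_comm, norm_mul, mul_comm, norm_eq_abs, norm_eq_abs]
  exact mul_le_mul_of_nonneg_right (abs_besselSeries_mul_le hs u z) (abs_nonneg _)

theorem hankelTransform_const_mul (c : ℝ) (z : ℝ) :
    hankelTransform s (fun u => c * φ u) z = c * hankelTransform s φ z := by
  simp only [hankelTransform, mul_left_comm _ c, integral_const_mul]

theorem hasSum_hankelTransform (hs : 0 < s) (hφ : ∀ u, 0 < u → 0 ≤ φ u) {M : ℕ → ℝ}
    (hM : ∀ k : ℕ, HasMoment φ (s + 2 * k) (M k)) (z : ℝ)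
    (hsum : Summable fun k : ℕ =>
      ((z / 2) ^ 2) ^ k / ((Nat.factorial k : ℝ) * Gamma (k + s / 2)) * M k) :
    HasSum (fun k : ℕ => (-(z / 2) ^ 2) ^ k / ((Nat.factorial k : ℝ) * Gamma (k + s / 2)) * M k)
      (hankelTransform s φ z) := by
  have hGamma : ∀ k : ℕ, 0 < Gamma (k + s / 2) := fun k =>
    Real.Gamma_pos_of_pos (by positivity)
  have h := HasMoment.hasSum_integral_tsum hφ hM
    (c := fun k => (-(z / 2) ^ 2) ^ k / ((Nat.factorial k : ℝ) * Gamma (k + s / 2)))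
    (hsum.congr fun k => by
      rw [abs_div, abs_pow, abs_neg, abs_of_nonneg (sq_nonneg _),
        abs_of_pos (mul_pos (by positivity) (hGamma k))])
  refine (congrArg (HasSum _) (setIntegral_congr_fun measurableSet_Ioi fun u _ => ?_)).mp h
  simp only [besselSeries]
  congr 2
  refine tsum_congr fun k => ?_
  rw [neg_pow, ← pow_mul, mul_div_assoc u, mul_pow,
    show (k : ℝ) + (s / 2 - 1) + 1 = k + s / 2 by ring]
  ring

theorem hankelTransform_exp_neg_mul_sq (hs : 0 < s) {p : ℝ} (hp : 0 < p) (z : ℝ) :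
    hankelTransform s (fun u => exp (-p * u ^ 2)) z =
      p ^ (-(s / 2)) / 2 * exp (-z ^ 2 / (4 * p)) := by
  have hterm : ∀ (y : ℝ) (k : ℕ), y ^ k / ((Nat.factorial k : ℝ) * Gamma (k + s / 2)) *
      (p ^ (-((s + 2 * k) / 2)) * Gamma ((s + 2 * k) / 2) / 2) =
      p ^ (-(s / 2)) / 2 * ((y / p) ^ k / (Nat.factorial k : ℝ)) := fun y k => by
    have : 0 < Gamma (k + s / 2) := Real.Gamma_pos_of_pos (by positivity)
    rw [show (s + 2 * k) / 2 = k + s / 2 by ring, neg_add_rev, rpow_add hp, rpow_neg hp.le k,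
      rpow_natCast, div_pow]
    field_simp
  have h := hasSum_hankelTransform hs (fun u _ => (exp_pos (-p * u ^ 2)).le)
    (fun k => hasMoment_exp_neg_mul_sq (by positivity) hp) z (by
      simp only [hterm]
      exact (Real.summable_pow_div_factorial _).mul_left _)
  simp only [hterm] at h
  have hexp := NormedSpace.expSeries_div_hasSum_exp (-(z / 2) ^ 2 / p : ℝ)
  rw [← Real.exp_eq_exp_ℝ] at hexp
  rw [h.unique (hexp.mul_left _)]
  congr 2
  ring

theorem hankelTransform_integral (hs : 1 ≤ s) {k : ℝ → ℝ → ℝ}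
    (hk : Integrable (fun q : ℝ × ℝ => q.1 ^ (s - 1) * k q.1 q.2)
      ((volume.restrict (Ioi 0)).prod (volume.restrict (Ioi 0)))) (z : ℝ) :
    hankelTransform s (fun r => ∫ w in Ioi 0, k r w) z =
      ∫ w in Ioi 0, hankelTransform s (fun r => k r w) z := by
  have hbessel := (continuous_besselSeries (a := s / 2 - 1) (by linarith)).measurable
  have hprod : Integrable (Function.uncurry fun r w =>
      besselSeries (s / 2 - 1) (r * z) * (r ^ (s - 1) * k r w))
      ((volume.restrict (Ioi 0)).prod (volume.restrict (Ioi 0))) :=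
    hk.bdd_mul (hbessel.comp (by fun_prop)).aestronglyMeasurable
      (.of_forall fun q => abs_besselSeries_mul_le hs q.1 z)
  have hswap := integral_integral_swap hprod
  simp only [hankelTransform, ← integral_const_mul]
  simpa only [mul_assoc, mul_left_comm] using hswap

theorem integral_mul_hankelTransform_comm (hs : 1 ≤ s)
    (hφ : IntegrableOn (fun u => u ^ (s - 1) * φ u) (Ioi 0))
    (hψ : IntegrableOn (fun u => u ^ (s - 1) * ψ u) (Ioi 0)) :
    ∫ z in Ioi 0, z ^ (s - 1) * ψ z * hankelTransform s φ z =
      ∫ u in Ioi 0, u ^ (s - 1) * φ u * hankelTransform s ψ u := by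
  have hbessel := (continuous_besselSeries (a := s / 2 - 1) (by linarith)).measurable
  have hprod : Integrable (Function.uncurry fun z u =>
      besselSeries (s / 2 - 1) (u * z) * ((z ^ (s - 1) * ψ z) * (u ^ (s - 1) * φ u)))
      ((volume.restrict (Ioi 0)).prod (volume.restrict (Ioi 0))) :=
    (Integrable.mul_prod hψ hφ).bdd_mul (hbessel.comp (by fun_prop)).aestronglyMeasurable
      (.of_forall fun q => abs_besselSeries_mul_le hs q.2 q.1)
  have hswap := integral_integral_swap hprod
  simp only [hankelTransform, ← integral_const_mul]
  calc _ = _ := by congr! 4; ring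
    _ = _ := hswap
    _ = _ := by congr! 4 with u _ z; rw [mul_comm u z]; ring

/-- The correlation function `φ` of an isotropic random field in dimension `s`, with the regularity
at the origin and at infinity under which its spectral density exists and can be inverted. -/
structure IsIntegrableCorrelation (s : ℝ) (φ : ℝ → ℝ) : Prop where
  measurable_indicator : Measurable ((Ioi 0).indicator φ)
  abs_le_one : ∀ u, 0 < u → |φ u| ≤ 1
  tendsto_one : Tendsto φ (𝓝[>] 0) (𝓝 1)
  integrableOn : IntegrableOn (fun u => u ^ (s - 1) * φ u) (Ioi 0)

namespace IsIntegrableCorrelation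

theorem congr (hφ : IsIntegrableCorrelation s φ) (h : EqOn φ ψ (Ioi 0)) :
    IsIntegrableCorrelation s ψ where
  measurable_indicator := indicator_congr h ▸ hφ.measurable_indicator
  abs_le_one u hu := h hu ▸ hφ.abs_le_one u hu
  tendsto_one := hφ.tendsto_one.congr' (eventually_mem_nhdsWithin.mono h)
  integrableOn := hφ.integrableOn.congr_fun (fun u hu => by simp only [h hu]) measurableSet_Ioi

theorem of_integral_kernel {k : ℝ → ℝ → ℝ} (hk : Measurable (Function.uncurry k))
    (hk0 : ∀ r w, 0 < w → 0 ≤ k r w) (hle : ∀ r w, 0 < w → k r w ≤ k 0 w)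
    (hcont : ∀ w, 0 < w → Continuous fun r => k r w) (hone : ∫ w in Ioi 0, k 0 w = 1)
    (hint : IntegrableOn (fun r => r ^ (s - 1) * ∫ w in Ioi 0, k r w) (Ioi 0)) :
    IsIntegrableCorrelation s fun r => ∫ w in Ioi 0, k r w where
  measurable_indicator :=
    hk.stronglyMeasurable.integral_prod_right.measurable.indicator measurableSet_Ioi
  abs_le_one r _ := by
    rw [← hone, ← norm_eq_abs]
    refine norm_integral_le_of_norm_le (integrable_of_integral_eq_one hone) ?_
    filter_upwards [ae_restrict_mem measurableSet_Ioi] with w hw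
    exact (norm_of_nonneg (hk0 r w hw)).trans_le (hle r w hw)
  tendsto_one := by
    rw [← hone]
    refine (tendsto_integral_filter_of_dominated_convergence _
      (.of_forall fun r => (hk.comp measurable_prodMk_left).aestronglyMeasurable)
      (.of_forall fun r => ?_) (integrable_of_integral_eq_one hone) ?_).mono_left
      nhdsWithin_le_nhds
    · filter_upwards [ae_restrict_mem measurableSet_Ioi] with w hw
      exact (norm_of_nonneg (hk0 r w hw)).trans_le (hle r w hw)
    · filter_upwards [ae_restrict_mem measurableSet_Ioi] with w hw
      exact (hcont w hw).tendsto 0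
  integrableOn := hint

theorem integrableOn_rpow_mul_hankelTransform (hφ : IsIntegrableCorrelation s φ) (hs : 1 ≤ s)
    {e : ℝ} (he : s < e) (hdecay : HasPowerDecay (hankelTransform s φ) e) :
    IntegrableOn (fun z => z ^ (s - 1) * hankelTransform s φ z) (Ioi 0) := by
  have hmeas := measurable_hankelTransform (s := s) (by linarith) hφ.measurable_indicator
  obtain ⟨C, hC⟩ := hdecay
  rw [← Ioc_union_Ioi_eq_Ioi zero_le_one]
  refine IntegrableOn.union ?_ ?_
  · have hpow : IntegrableOn (fun z : ℝ => z ^ (s - 1)) (Ioc 0 1) :=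
      (intervalIntegrable_iff_integrableOn_Ioc_of_le zero_le_one).mp
        (intervalIntegral.intervalIntegrable_rpow' (by linarith))
    exact hpow.mul_bdd hmeas.aestronglyMeasurable
      (.of_forall fun z => abs_hankelTransform_le hs hφ.integrableOn z)
  · refine ((integrableOn_Ioi_rpow_of_lt (show s - 1 - e < -1 by linarith) one_pos).const_mul
      C).mono' ((measurable_id.pow_const _).mul hmeas).aestronglyMeasurable ?_
    filter_upwards [ae_restrict_mem measurableSet_Ioi] with z hz
    have hz : 0 < z := one_pos.trans hz
    rw [norm_mul, norm_of_nonneg (rpow_nonneg hz.le _), sub_eq_add_neg (s - 1), rpow_add hz,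
      mul_left_comm]
    exact mul_le_mul_of_nonneg_left (hC z hz) (rpow_nonneg hz.le _)

end IsIntegrableCorrelation

theorem integral_exp_mul_rpow_mul_hankelTransform (hs : 1 ≤ s)
    (hφ : IntegrableOn (fun u => u ^ (s - 1) * φ u) (Ioi 0)) {t : ℝ} (ht : 0 < t) :
    ∫ z in Ioi 0, exp (-(t * z) ^ 2 / 4) * (z ^ (s - 1) * hankelTransform s φ z) =
      2 ^ (s - 1) * ∫ v in Ioi 0, φ (t * v) * (v ^ (s - 1) * exp (-1 * v ^ 2)) := by
  have hp : 0 < t ^ 2 / 4 := by positivity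
  have hconst : t * (t ^ (s - 1) * ((t ^ 2 / 4) ^ (-(s / 2)) / 2)) = 2 ^ (s - 1) := by
    rw [show t ^ 2 / 4 = (t / 2) ^ (2 : ℝ) by rw [rpow_two]; ring, ← rpow_mul (by positivity),
      show 2 * -(s / 2) = -s by ring, rpow_neg (by positivity), div_rpow ht.le zero_le_two,
      rpow_sub_one ht.ne', rpow_sub_one two_ne_zero]
    field_simp
  have hsubst := integral_comp_mul_left_Ioi (fun u => u ^ (s - 1) * φ u *
    ((t ^ 2 / 4) ^ (-(s / 2)) / 2 * exp (-u ^ 2 / (4 * (t ^ 2 / 4))))) 0 ht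
  rw [mul_zero, smul_eq_mul, eq_inv_mul_iff_mul_eq₀ ht.ne'] at hsubst
  calc _ = ∫ z in Ioi 0, z ^ (s - 1) * exp (-(t ^ 2 / 4) * z ^ 2) * hankelTransform s φ z := by
        congr! 2 with z
        rw [show -(t * z) ^ 2 / 4 = -(t ^ 2 / 4) * z ^ 2 by ring]
        ring
    _ = _ := integral_mul_hankelTransform_comm hs hφ
        (hasMoment_exp_neg_mul_sq (by linarith) hp).1
    _ = _ := by simp only [hankelTransform_exp_neg_mul_sq (by linarith : 0 < s) hp]
    _ = _ := hsubst.symm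
    _ = _ := by
        rw [← integral_const_mul t, ← integral_const_mul (2 ^ (s - 1))]
        refine setIntegral_congr_fun measurableSet_Ioi fun v (hv : 0 < v) => ?_
        simp only [mul_rpow ht.le hv.le, ← hconst]
        rw [show -(t * v) ^ 2 / (4 * (t ^ 2 / 4)) = -1 * v ^ 2 by field_simp]
        ring

theorem tendsto_setIntegral_comp_mul_mul {f g : ℝ → ℝ}
    (hf : Measurable ((Ioi 0).indicator f))
    (hf1 : ∀ u, 0 < u → |f u| ≤ 1) (hf0 : Tendsto f (𝓝[>] 0) (𝓝 1))
    (hg : IntegrableOn g (Ioi 0)) :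
    Tendsto (fun t => ∫ v in Ioi 0, f (t * v) * g v) (𝓝[>] 0) (𝓝 (∫ v in Ioi 0, g v)) := by
  refine tendsto_integral_filter_of_dominated_convergence (fun v => ‖g v‖) ?_ ?_ hg.norm ?_
  · filter_upwards [self_mem_nhdsWithin] with t ht
    refine ((hf.comp (measurable_const_mul t)).aestronglyMeasurable.congr ?_).mul
      hg.aestronglyMeasurable
    filter_upwards [ae_restrict_mem measurableSet_Ioi] with v hv
    exact indicator_of_mem (mul_pos ht hv) f
  · filter_upwards [self_mem_nhdsWithin] with t ht
    filter_upwards [ae_restrict_mem measurableSet_Ioi] with v hv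
    rw [norm_mul]
    exact mul_le_of_le_one_left (norm_nonneg _) (hf1 _ (mul_pos ht hv))
  · filter_upwards [ae_restrict_mem measurableSet_Ioi] with v (hv : 0 < v)
    have hscale : Tendsto (fun t : ℝ => t * v) (𝓝[>] 0) (𝓝[>] 0) :=
      tendsto_nhdsWithin_iff.mpr ⟨((continuous_mul_const v).tendsto' 0 0 (zero_mul v)).mono_left
        nhdsWithin_le_nhds, by filter_upwards [self_mem_nhdsWithin] with t ht using mul_pos ht hv⟩
    simpa using (hf0.comp hscale).mul_const (g v)

namespace IsIntegrableCorrelation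

theorem integral_rpow_mul_hankelTransform (hφ : IsIntegrableCorrelation s φ) (hs : 1 ≤ s)
    (hint : IntegrableOn (fun z => z ^ (s - 1) * hankelTransform s φ z) (Ioi 0)) :
    ∫ z in Ioi 0, z ^ (s - 1) * hankelTransform s φ z = 2 ^ (s - 2) * Gamma (s / 2) := by
  have hGauss := hasMoment_exp_neg_mul_sq (s := s) (by linarith) one_pos
  have hleft := tendsto_setIntegral_comp_mul_mul (f := fun x => exp (-x ^ 2 / 4))
    (.indicator (by fun_prop) measurableSet_Ioi)
    (fun u _ => by rw [abs_exp, exp_le_one_iff]; linarith [sq_nonneg u])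
    (((by fun_prop : Continuous fun x : ℝ => exp (-x ^ 2 / 4)).tendsto' 0 1 (by simp)).mono_left
      nhdsWithin_le_nhds) hint
  have hright := (tendsto_setIntegral_comp_mul_mul hφ.measurable_indicator hφ.abs_le_one
    hφ.tendsto_one hGauss.1).const_mul (2 ^ (s - 1))
  have hlimit := tendsto_nhds_unique (hleft.congr' (by
    filter_upwards [self_mem_nhdsWithin] with t ht
    exact integral_exp_mul_rpow_mul_hankelTransform hs hφ.integrableOn ht)) hright
  rw [hlimit, hGauss.2, one_rpow, one_mul, show s - 1 = s - 2 + 1 by ring,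
    rpow_add_one two_ne_zero]
  ring

theorem integral_pow_mul_spectralDensity {d : ℕ} (hφ : IsIntegrableCorrelation d φ) (hd : 1 ≤ d)
    {e : ℝ} (he : d < e) (hdecay : HasPowerDecay (spectralDensity d φ) e) :
    IntegrableOn (fun z => z ^ (d - 1) * spectralDensity d φ z) (Ioi 0) ∧
      ∫ z in Ioi 0, z ^ (d - 1) * spectralDensity d φ z =
        Gamma ((d : ℝ) / 2) / (2 * π ^ ((d : ℝ) / 2)) := by
  have hd1 : (1 : ℝ) ≤ d := mod_cast hd
  set c : ℝ := 2 ^ (1 - (d : ℝ)) * π ^ (-(d : ℝ) / 2) with hc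
  have hc0 : c ≠ 0 := by positivity
  have hint := hφ.integrableOn_rpow_mul_hankelTransform hd1 he <|
    (hdecay.const_mul c⁻¹).congr fun z hz => by
      simp only [spectralDensity_eq_hankelTransform d φ hz, ← hc, inv_mul_cancel_left₀ hc0]
  have h : EqOn (fun z => c * (z ^ ((d : ℝ) - 1) * hankelTransform d φ z))
      (fun z => z ^ (d - 1) * spectralDensity d φ z) (Ioi 0) := fun z hz => by
    simp only [spectralDensity_eq_hankelTransform d φ hz, ← hc, ← rpow_natCast z,
      Nat.cast_sub hd, Nat.cast_one]
    ring
  refine ⟨IntegrableOn.congr_fun (hint.const_mul c) h measurableSet_Ioi, ?_⟩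
  rw [← setIntegral_congr_fun measurableSet_Ioi h, integral_const_mul,
    hφ.integral_rpow_mul_hankelTransform hd1 hint, hc, neg_div, rpow_neg pi_pos.le,
    rpow_sub two_pos, rpow_sub two_pos, rpow_one, rpow_two]
  field_simp

end IsIntegrableCorrelation
end HankelTransform

section MulExp

variable {c : ℝ}

theorem image_univ_mul_exp (hc : 0 < c) : (fun t => c * exp t) '' univ = Ioi 0 := by
  ext w
  simp only [image_univ, mem_range, mem_Ioi]
  refine ⟨?_, fun hw => ⟨log (w / c), ?_⟩⟩
  · rintro ⟨t, rfl⟩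
    positivity
  · rw [exp_log (by positivity)]
    field_simp

theorem injOn_mul_exp (hc : 0 < c) : InjOn (fun t => c * exp t) univ :=
  fun _ _ _ _ hst => exp_injective (mul_left_cancel₀ hc.ne' hst)

theorem hasDerivWithinAt_mul_exp (c t : ℝ) :
    HasDerivWithinAt (fun t => c * exp t) (c * exp t) univ t :=
  ((hasDerivAt_exp t).const_mul c).hasDerivWithinAt

theorem integrable_mul_exp_mul_comp_iff (hc : 0 < c) (g : ℝ → ℝ) :
    Integrable (fun t => c * exp t * g (c * exp t)) ↔ IntegrableOn g (Ioi 0) := by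
  have h : ∀ t, |c * exp t| = c * exp t := fun t => abs_of_pos (by positivity)
  rw [← image_univ_mul_exp hc, integrableOn_image_iff_integrableOn_abs_deriv_smul MeasurableSet.univ
    (fun t _ => hasDerivWithinAt_mul_exp c t) (injOn_mul_exp hc), integrableOn_univ]
  simp only [h, smul_eq_mul]

theorem integral_mul_exp_mul_comp (hc : 0 < c) (g : ℝ → ℝ) :
    ∫ t, c * exp t * g (c * exp t) = ∫ w in Ioi 0, g w := by
  have h : ∀ t, |c * exp t| = c * exp t := fun t => abs_of_pos (by positivity)
  rw [← image_univ_mul_exp hc, integral_image_eq_integral_abs_deriv_smul MeasurableSet.univ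
    (fun t _ => hasDerivWithinAt_mul_exp c t) (injOn_mul_exp hc), setIntegral_univ]
  simp only [h, smul_eq_mul]

end MulExp

section Matern

variable {κ β : ℝ}

theorem besselK_eq_integral_mul_exp {x : ℝ}
    (h : Integrable fun t => exp (-x * cosh t) * exp (κ * t)) :
    besselK κ x = (∫ t, exp (-x * cosh t) * exp (κ * t)) / 2 := by
  have hneg := integral_comp_neg_Ioi 0 fun t => exp (-x * cosh t) * exp (κ * t)
  rw [neg_zero] at hneg
  rw [eq_div_iff two_ne_zero,
    ← intervalIntegral.integral_Iic_add_Ioi h.integrableOn h.integrableOn (b := 0), ← hneg,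
    ← integral_add h.comp_neg.integrableOn h.integrableOn, besselK, ← integral_mul_const]
  congr 1
  funext t
  rw [cosh_neg, cosh_eq (κ * t), mul_neg]
  ring

theorem integrableOn_rpow_mul_exp_neg (hκ : 0 < κ) :
    IntegrableOn (fun w : ℝ => w ^ (κ - 1) * exp (-w)) (Ioi 0) :=
  (Real.GammaIntegral_convergent hκ).congr_fun (fun _ _ => mul_comm _ _) measurableSet_Ioi

theorem besselK_eq_integral_rpow (hκ : 0 < κ) {x : ℝ} (hx : 0 < x) :
    besselK κ x = (x / 2) ^ (-κ) / 2 *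
      ∫ w in Ioi 0, w ^ (κ - 1) * exp (-w) * exp (-(x / 2) ^ 2 / w) := by
  have hc : 0 < x / 2 := by positivity
  set g : ℝ → ℝ := fun w => w ^ (κ - 1) * exp (-w) * exp (-(x / 2) ^ 2 / w) with hg
  have hgi : IntegrableOn g (Ioi 0) := by
    refine (integrableOn_rpow_mul_exp_neg hκ).mul_bdd (c := 1) (by fun_prop) ?_
    filter_upwards [ae_restrict_mem measurableSet_Ioi] with w hw
    rw [norm_eq_abs, abs_exp, exp_le_one_iff]
    exact div_nonpos_of_nonpos_of_nonneg (neg_nonpos.mpr (sq_nonneg _)) (le_of_lt hw)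
  have hsubst : ∀ t, exp (-x * cosh t) * exp (κ * t) =
      (x / 2) ^ (-κ) * (x / 2 * exp t * g (x / 2 * exp t)) := fun t => by
    have hcosh : -x * cosh t = -(x / 2 * exp t) + -(x / 2) ^ 2 / (x / 2 * exp t) := by
      rw [cosh_eq, exp_neg]
      field_simp
      ring
    rw [hcosh, exp_add]
    simp only [hg]
    rw [rpow_sub_one (by positivity), mul_rpow hc.le (exp_pos t).le, ← exp_mul,
      mul_comm t κ, rpow_neg hc.le]
    field_simp
  rw [besselK_eq_integral_mul_exp, funext hsubst, integral_const_mul, integral_mul_exp_mul_comp hc,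
    div_mul_eq_mul_div]
  rw [funext hsubst]
  exact ((integrable_mul_exp_mul_comp_iff hc g).mpr hgi).const_mul _

/-- The Gaussian of variance `2 β² w` in the variable `r`, weighted by the density in `w` of the
gamma distribution of shape `κ`: the Matérn function is the integral of this kernel over `w`. -/
noncomputable def maternKernel (κ β r w : ℝ) : ℝ :=
  w ^ (κ - 1) * exp (-w) / Gamma κ * exp (-((2 * β) ^ 2 * w)⁻¹ * r ^ 2)

theorem matern_eq_integral (hκ : 0 < κ) (hβ : 0 < β) {r : ℝ} (hr : 0 < r) :
    matern κ β r = ∫ w in Ioi 0, maternKernel κ β r w := by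
  have hconst : (2 : ℝ) ^ (1 - κ) * (r / β) ^ κ * ((r / β / 2) ^ (-κ) / 2) = 1 := by
    rw [rpow_neg (by positivity), div_rpow (by positivity) zero_le_two, rpow_sub two_pos, rpow_one]
    have : 0 < (r / β) ^ κ := by positivity
    have : (0 : ℝ) < 2 ^ κ := by positivity
    field_simp
  have hkernel : ∀ w, maternKernel κ β r w =
      (Gamma κ)⁻¹ * (w ^ (κ - 1) * exp (-w) * exp (-(r / β / 2) ^ 2 / w)) := fun w => by
    rw [maternKernel, show -((2 * β) ^ 2 * w)⁻¹ * r ^ 2 = -(r / β / 2) ^ 2 / w by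
      rw [mul_inv]; field_simp]
    ring
  simp only [hkernel, integral_const_mul]
  rw [matern, if_neg hr.ne', besselK_eq_integral_rpow hκ (by positivity : 0 < r / β)]
  linear_combination ((Gamma κ)⁻¹ * ∫ w in Ioi (0 : ℝ),
    w ^ (κ - 1) * exp (-w) * exp (-(r / β / 2) ^ 2 / w)) * hconst

theorem maternKernel_nonneg (hκ : 0 < κ) (r : ℝ) {w : ℝ} (hw : 0 < w) :
    0 ≤ maternKernel κ β r w := by
  have := Real.Gamma_pos_of_pos hκ
  rw [maternKernel]
  positivity

theorem measurable_maternKernel (κ β : ℝ) : Measurable (Function.uncurry (maternKernel κ β)) := by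
  simp only [Function.uncurry_def, maternKernel]
  fun_prop

theorem inv_sq_mul_rpow_neg_half {b w : ℝ} (hb : 0 < b) (hw : 0 < w) (s : ℝ) :
    (b ^ 2 * w)⁻¹ ^ (-(s / 2)) = b ^ s * w ^ (s / 2) := by
  rw [inv_rpow (by positivity), rpow_neg (by positivity), inv_inv, mul_rpow (by positivity) hw.le,
    ← rpow_natCast b 2, ← rpow_mul hb.le, Nat.cast_ofNat, mul_div_cancel₀ s two_ne_zero]

theorem integrable_rpow_mul_maternKernel (hκ : 0 < κ) (hβ : 0 < β) {s : ℝ} (hs : 0 < s) :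
    Integrable (fun q : ℝ × ℝ => q.1 ^ (s - 1) * maternKernel κ β q.1 q.2)
      ((volume.restrict (Ioi 0)).prod (volume.restrict (Ioi 0))) := by
  refine HasMoment.integrable_prod (measurable_maternKernel κ β)
    (fun r _ w hw => maternKernel_nonneg hκ r hw)
    (fun w hw => (hasMoment_exp_neg_mul_sq hs (by positivity)).const_mul _) ?_
  refine IntegrableOn.congr_fun ((integrableOn_rpow_mul_exp_neg (κ := κ + s / 2)
    (by positivity)).const_mul ((2 * β) ^ s * Gamma (s / 2) / (2 * Gamma κ)))
    (fun w (hw : 0 < w) => ?_) measurableSet_Ioi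
  simp only [inv_sq_mul_rpow_neg_half (mul_pos two_pos hβ) hw, add_sub_right_comm κ (s / 2),
    rpow_add hw]
  ring

theorem isIntegrableCorrelation_matern (hκ : 0 < κ) (hβ : 0 < β) {s : ℝ} (hs : 0 < s) :
    IsIntegrableCorrelation s (matern κ β) := by
  have hzero : ∀ w, maternKernel κ β 0 w = w ^ (κ - 1) * exp (-w) / Gamma κ := fun w => by
    simp [maternKernel]
  refine IsIntegrableCorrelation.congr (φ := fun r => ∫ w in Ioi 0, maternKernel κ β r w)
    (.of_integral_kernel (measurable_maternKernel κ β) (fun r w hw => maternKernel_nonneg hκ r hw)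
      (fun r w hw => ?_) (fun w _ => ?_) ?_ ?_) fun r hr => (matern_eq_integral hκ hβ hr).symm
  · have := Real.Gamma_pos_of_pos hκ
    rw [hzero]
    refine mul_le_of_le_one_right (by positivity) (exp_le_one_iff.mpr ?_)
    rw [neg_mul]
    exact neg_nonpos.mpr (by positivity)
  · simp only [maternKernel]
    fun_prop
  · simp only [hzero, integral_div]
    rw [div_eq_one_iff_eq (Real.Gamma_pos_of_pos hκ).ne', Real.Gamma_eq_integral hκ]
    simp only [mul_comm]
  · simp only [← integral_const_mul]
    exact (integrable_rpow_mul_maternKernel hκ hβ hs).integral_prod_left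

theorem hankelTransform_maternKernel (hβ : 0 < β) {s : ℝ} (hs : 0 < s) (z : ℝ) {w : ℝ}
    (hw : 0 < w) : hankelTransform s (fun r => maternKernel κ β r w) z =
      (2 * β) ^ s / (2 * Gamma κ) * (w ^ (κ + s / 2 - 1) * exp (-((1 + β ^ 2 * z ^ 2) * w))) := by
  have hexp : exp (-((1 + β ^ 2 * z ^ 2) * w)) =
      exp (-w) * exp (-z ^ 2 / (4 * ((2 * β) ^ 2 * w)⁻¹)) := by
    rw [← exp_add]; congr 1; field_simp; ring
  simp only [maternKernel, hankelTransform_const_mul]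
  rw [hankelTransform_exp_neg_mul_sq hs (by positivity), hexp,
    inv_sq_mul_rpow_neg_half (mul_pos two_pos hβ) hw, add_sub_right_comm κ (s / 2), rpow_add hw]
  ring

theorem hankelTransform_matern (hκ : 0 < κ) (hβ : 0 < β) {s : ℝ} (hs : 1 ≤ s) (z : ℝ) :
    hankelTransform s (matern κ β) z = (2 * β) ^ s * Gamma (κ + s / 2) / (2 * Gamma κ) /
      (1 + β ^ 2 * z ^ 2) ^ (κ + s / 2) := by
  have hs0 : 0 < s := by linarith
  have hb : 0 < 1 + β ^ 2 * z ^ 2 := by positivity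
  rw [hankelTransform_congr fun r hr => matern_eq_integral hκ hβ hr,
    hankelTransform_integral hs (integrable_rpow_mul_maternKernel hκ hβ hs0),
    setIntegral_congr_fun measurableSet_Ioi fun w hw => hankelTransform_maternKernel hβ hs0 z hw,
    integral_const_mul, Real.integral_rpow_mul_exp_neg_mul_Ioi (by positivity) hb, one_div,
    inv_rpow hb.le]
  ring

theorem spectralDensity_matern (hκ : 0 < κ) (hβ : 0 < β) {d : ℕ} (hd : 1 ≤ d) {z : ℝ}
    (hz : 0 < z) : spectralDensity d (matern κ β) z = maternSpectral d κ β z := by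
  rw [spectralDensity_eq_hankelTransform d _ hz, hankelTransform_matern hκ hβ (mod_cast hd),
    maternSpectral, mul_rpow zero_le_two hβ.le, rpow_natCast, rpow_natCast, neg_div,
    rpow_neg pi_pos.le, rpow_sub two_pos, rpow_one, rpow_natCast]
  field_simp

theorem hasPowerDecay_maternSpectral (d : ℕ) (hκ : 0 < κ) (hβ : 0 < β) :
    HasPowerDecay (maternSpectral d κ β) (2 * κ + d) := by
  have hdecay : HasPowerDecay (fun z => β ^ d / (1 + β ^ 2 * z ^ 2) ^ (κ + (d : ℝ) / 2))
      (2 * κ + d) := by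
    refine ⟨β ^ d / (β ^ 2) ^ (κ + (d : ℝ) / 2), fun z hz => ?_⟩
    rw [abs_of_pos (by positivity), rpow_neg hz.le, ← div_eq_mul_inv, div_div,
      show 2 * κ + d = 2 * (κ + (d : ℝ) / 2) by ring, rpow_mul hz.le, rpow_two,
      ← mul_rpow (by positivity) (by positivity)]
    refine div_le_div_of_nonneg_left (by positivity) (by positivity)
      (rpow_le_rpow (by positivity) (by linarith) (by positivity))
  exact hdecay.const_mul _

end Matern

theorem ascPochhammer_eval_le {x y : ℝ} (hx : 0 < x) (hxy : x ≤ y) (k : ℕ) :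
    (ascPochhammer ℝ k).eval x ≤ (ascPochhammer ℝ k).eval y := by
  induction k with
  | zero => simp
  | succ k ih =>
    rw [ascPochhammer_succ_eval, ascPochhammer_succ_eval]
    have := ascPochhammer_pos k y (hx.trans_le hxy)
    gcongr

theorem ascPochhammer_succ_eval_left (x : ℝ) (n : ℕ) :
    (ascPochhammer ℝ (n + 1)).eval x = x * (ascPochhammer ℝ n).eval (x + 1) := by
  simp [ascPochhammer_succ_left]

theorem inv_ascPochhammer_eval_add_one_sub {x : ℝ} (hx : 0 < x) (n : ℕ) :
    ((ascPochhammer ℝ n).eval (x + 1))⁻¹ - ((ascPochhammer ℝ n).eval x)⁻¹ =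
      -n / (ascPochhammer ℝ (n + 1)).eval x := by
  have hpos := ascPochhammer_pos n x hx
  have hpos' := ascPochhammer_pos n (x + 1) (by positivity)
  have hsucc := ascPochhammer_succ_eval (S := ℝ) n x
  rw [ascPochhammer_succ_eval_left] at hsucc ⊢
  field_simp
  linear_combination -hsucc

theorem summable_hypergeometric1F2 {a b c : ℝ} (ha : 0 < a) (hab : a ≤ b) (hc : 0 < c) (x : ℝ) :
    Summable fun k : ℕ => (ascPochhammer ℝ k).eval a /
      ((ascPochhammer ℝ k).eval b * (ascPochhammer ℝ k).eval c) *
        (x ^ k / (Nat.factorial k : ℝ)) := by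
  have hm : 0 < min 1 c := lt_min one_pos hc
  refine Summable.of_norm_bounded
    ((Real.summable_pow_div_factorial |x|).mul_left (min 1 c)⁻¹) fun k => ?_
  have hpa := ascPochhammer_pos k a ha
  have hpb := ascPochhammer_pos k b (ha.trans_le hab)
  have hpc := ascPochhammer_pos k c hc
  rw [norm_mul, norm_div (x ^ k), norm_pow, Real.norm_natCast, norm_eq_abs x,
    norm_of_nonneg (by positivity), ← div_div, div_eq_mul_inv _ ((ascPochhammer ℝ k).eval c)]
  gcongr
  exact (mul_le_of_le_one_left (by positivity)
    ((div_le_one hpb).mpr (ascPochhammer_eval_le ha hab k))).trans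
    (inv_anti₀ hm (min_one_le_ascPochhammer_eval hc k))

/-- The function `₁F₂(l; r/2, (r+1)/2; -x²/4)`. By the duplication formula its two lower parameters
merge into the single Pochhammer symbol `(r)_{2k}`, which is what makes `r` a useful parameter. -/
noncomputable def hypergeometric1F2Dup (l r x : ℝ) : ℝ :=
  hypergeometric1F2 l (r / 2) ((r + 1) / 2) (-x ^ 2 / 4)

section Hypergeometric1F2Dup

variable {l r : ℝ}

theorem hasSum_hypergeometric1F2Dup (hl : 0 < l) (hr : 2 * l ≤ r) (x : ℝ) :
    HasSum (fun k : ℕ => (ascPochhammer ℝ k).eval l / (ascPochhammer ℝ (2 * k)).eval r *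
      ((-x ^ 2) ^ k / (Nat.factorial k : ℝ))) (hypergeometric1F2Dup l r x) := by
  refine (summable_hypergeometric1F2 hl (by linarith : l ≤ r / 2) (by linarith) _).hasSum.congr_fun
    fun k => ?_
  rw [ascPochhammer_eval_two_mul, div_pow]
  field_simp

theorem hypergeometric1F2Dup_add_one_sub (hl : 0 < l) (hr : 2 * l ≤ r) (x : ℝ) :
    hypergeometric1F2Dup l (r + 1) x - hypergeometric1F2Dup l r x =
      2 * l * x ^ 2 / (r * (r + 1) * (r + 2)) * hypergeometric1F2Dup (l + 1) (r + 3) x := by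
  have hr0 : 0 < r := by linarith
  have hdiff := (hasSum_hypergeometric1F2Dup hl (by linarith : 2 * l ≤ r + 1) x).sub
    (hasSum_hypergeometric1F2Dup hl hr x)
  have hshift := HasSum.zero_add (f := fun k : ℕ =>
    (ascPochhammer ℝ k).eval l * (-((2 * k : ℕ) : ℝ) / (ascPochhammer ℝ (2 * k + 1)).eval r) *
      ((-x ^ 2) ^ k / (Nat.factorial k : ℝ))) <|
    ((hasSum_hypergeometric1F2Dup (by linarith : 0 < l + 1)
      (by linarith : 2 * (l + 1) ≤ r + 3) x).mul_left
        (2 * l * x ^ 2 / (r * (r + 1) * (r + 2)))).congr_fun fun k => by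
      have hpos := ascPochhammer_pos (2 * k) (r + 3) (by positivity)
      rw [show 2 * (k + 1) + 1 = 2 * k + 1 + 1 + 1 by ring]
      simp only [ascPochhammer_succ_eval_left, Nat.factorial_succ]
      rw [show r + 1 + 1 = r + 2 by ring, show r + 2 + 1 = r + 3 by ring]
      push_cast
      field_simp
      ring
  rw [mul_zero, Nat.cast_zero, neg_zero, zero_div, mul_zero, zero_mul, zero_add] at hshift
  refine hdiff.unique (hshift.congr_fun fun k => ?_)
  rw [← inv_ascPochhammer_eval_add_one_sub hr0]
  ring

theorem HasPowerDecay.hypergeometric1F2Dup_add_one {e : ℝ}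
    (h : HasPowerDecay (hypergeometric1F2Dup l r) e) (hl : 0 < l) (hr : 2 * l ≤ r)
    (h' : HasPowerDecay (hypergeometric1F2Dup l (r + 1)) e) :
    HasPowerDecay (hypergeometric1F2Dup (l + 1) (r + 3)) (e + 2) := by
  obtain ⟨C, hC⟩ := h
  obtain ⟨C', hC'⟩ := h'
  have hr0 : 0 < r := by linarith
  refine ⟨r * (r + 1) * (r + 2) / (2 * l) * (C' + C), fun x hx => ?_⟩
  have hcontig : hypergeometric1F2Dup (l + 1) (r + 3) x = r * (r + 1) * (r + 2) / (2 * l) *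
      (x ^ 2)⁻¹ * (hypergeometric1F2Dup l (r + 1) x - hypergeometric1F2Dup l r x) := by
    rw [hypergeometric1F2Dup_add_one_sub hl hr]
    field_simp
  have hdiff := (abs_sub _ _).trans (add_le_add (hC' x hx) (hC x hx))
  rw [hcontig, abs_mul, abs_of_pos (by positivity), neg_add, rpow_add hx, rpow_neg hx.le 2,
    rpow_two]
  calc _ ≤ r * (r + 1) * (r + 2) / (2 * l) * (x ^ 2)⁻¹ * (C' * x ^ (-e) + C * x ^ (-e)) := by
        gcongr
    _ = _ := by ring

theorem beta_add_natCast {q : ℝ} (hr : 0 < r) (hq : 0 < q) (k : ℕ) :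
    ProbabilityTheory.beta (r + k) q = ProbabilityTheory.beta r q *
      ((ascPochhammer ℝ k).eval r / (ascPochhammer ℝ k).eval (r + q)) := by
  have hpos := ascPochhammer_pos k (r + q) (by positivity)
  have : 0 < Gamma (r + q) := Real.Gamma_pos_of_pos (by positivity)
  rw [ProbabilityTheory.beta, ProbabilityTheory.beta, add_comm r k, add_assoc,
    Gamma_natCast_add hr, Gamma_natCast_add (by positivity : 0 < r + q)]
  field_simp

theorem integral_mul_hypergeometric1F2Dup {q : ℝ} (hl : 0 < l) (hr : 2 * l ≤ r) (hq : 0 < q)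
    (x : ℝ) :
    ∫ t in Ioi 0, t ^ (r - 1) * hypergeometric1F2Dup l r (x * t) * truncPow (q - 1) (1 - t) =
      ProbabilityTheory.beta r q * hypergeometric1F2Dup l (r + q) x := by
  have hr0 : 0 < r := by linarith
  have hmoment : ∀ k : ℕ, HasMoment (fun t => truncPow (q - 1) (1 - t)) (r + 2 * k)
      (ProbabilityTheory.beta r q *
        ((ascPochhammer ℝ (2 * k)).eval r / (ascPochhammer ℝ (2 * k)).eval (r + q))) := fun k => by
    rw [← beta_add_natCast hr0 hq]
    push_cast
    exact hasMoment_truncPow_one_sub (by positivity) hq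
  have hterm : ∀ k : ℕ, (ascPochhammer ℝ k).eval l / (ascPochhammer ℝ (2 * k)).eval r *
      ((-x ^ 2) ^ k / (Nat.factorial k : ℝ)) * (ProbabilityTheory.beta r q *
        ((ascPochhammer ℝ (2 * k)).eval r / (ascPochhammer ℝ (2 * k)).eval (r + q))) =
      ProbabilityTheory.beta r q * ((ascPochhammer ℝ k).eval l /
        (ascPochhammer ℝ (2 * k)).eval (r + q) * ((-x ^ 2) ^ k / (Nat.factorial k : ℝ))) :=
    fun k => by
      have := ascPochhammer_pos (2 * k) r hr0
      field_simp
  have hsum := (hasSum_hypergeometric1F2Dup hl (by linarith : 2 * l ≤ r + q) x).mul_left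
    (ProbabilityTheory.beta r q)
  have h := HasMoment.hasSum_integral_tsum (fun t _ => truncPow_nonneg (q - 1) (1 - t)) hmoment
    (c := fun k => (ascPochhammer ℝ k).eval l / (ascPochhammer ℝ (2 * k)).eval r *
      ((-x ^ 2) ^ k / (Nat.factorial k : ℝ))) (hsum.summable.abs.congr fun k => by
        rw [← hterm, abs_mul, abs_of_nonneg (a := ProbabilityTheory.beta r q * _)]
        have := ascPochhammer_pos (2 * k) r hr0
        have := ascPochhammer_pos (2 * k) (r + q) (by positivity)
        have := ProbabilityTheory.beta_pos hr0 hq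
        positivity)
  simp only [hterm] at h
  rw [← h.unique hsum]
  refine setIntegral_congr_fun measurableSet_Ioi fun t _ => ?_
  simp only [← (hasSum_hypergeometric1F2Dup hl hr (x * t)).tsum_eq]
  congr! 4 with k
  rw [mul_pow, ← neg_mul, mul_pow, ← pow_mul]
  ring

theorem HasPowerDecay.hypergeometric1F2Dup_add {e q : ℝ}
    (h : HasPowerDecay (hypergeometric1F2Dup l r) e) (hl : 0 < l) (hr : 2 * l ≤ r) (he : e < r)
    (hq : 0 < q) : HasPowerDecay (hypergeometric1F2Dup l (r + q)) e := by
  obtain ⟨C, hC⟩ := h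
  have hB := ProbabilityTheory.beta_pos (by linarith : 0 < r) hq
  obtain ⟨hint, hval⟩ := hasMoment_truncPow_one_sub (by linarith : 0 < r - e) hq
  refine ⟨C * ProbabilityTheory.beta (r - e) q / ProbabilityTheory.beta r q, fun x hx => ?_⟩
  rw [div_mul_eq_mul_div, le_div_iff₀' hB]
  nth_rewrite 1 [← abs_of_pos hB]
  rw [← abs_mul, ← integral_mul_hypergeometric1F2Dup hl hr hq, mul_right_comm, ← hval,
    ← integral_const_mul (C * x ^ (-e)), ← norm_eq_abs]
  refine norm_integral_le_of_norm_le (hint.const_mul _) ?_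
  filter_upwards [ae_restrict_mem measurableSet_Ioi] with t (ht : 0 < t)
  rw [norm_mul, norm_mul, norm_of_nonneg (rpow_nonneg ht.le _),
    norm_of_nonneg (truncPow_nonneg _ _), norm_eq_abs]
  have hbound := hC (x * t) (mul_pos hx ht)
  rw [mul_rpow hx.le ht.le] at hbound
  have hpow : t ^ (r - e - 1) = t ^ (r - 1) * t ^ (-e) := by rw [← rpow_add ht]; congr 1; ring
  rw [hpow]
  calc _ ≤ t ^ (r - 1) * (C * (x ^ (-e) * t ^ (-e))) * truncPow (q - 1) (1 - t) := by
        gcongr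
        exact truncPow_nonneg _ _
    _ = _ := by ring

theorem hypergeometric1F2Dup_two_mul (hl : 0 < l) (x : ℝ) :
    hypergeometric1F2Dup l (2 * l) x = Gamma (l + 1 / 2) * besselSeries (l - 1 / 2) x := by
  rw [← (hasSum_hypergeometric1F2Dup hl le_rfl x).tsum_eq, besselSeries, ← tsum_mul_left]
  refine tsum_congr fun k => ?_
  have hpos := ascPochhammer_pos k l hl
  have := ascPochhammer_pos k (l + 1 / 2) (by positivity)
  have : 0 < Gamma (l + 1 / 2) := Real.Gamma_pos_of_pos (by positivity)
  rw [ascPochhammer_eval_two_mul, mul_div_cancel_left₀ l two_ne_zero,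
    show (2 * l + 1) / 2 = l + 1 / 2 by ring,
    show (k : ℝ) + (l - 1 / 2) + 1 = k + (l + 1 / 2) by ring,
    Gamma_natCast_add (by positivity), neg_pow (x ^ 2), pow_mul, div_pow x, div_pow]
  norm_num
  field_simp

theorem sq_mul_hypergeometric1F2Dup_one_three (x : ℝ) :
    x ^ 2 * hypergeometric1F2Dup 1 3 x = 2 * (1 - cos x) := by
  have hcos := ((hasSum_nat_add_iff' 1).mpr (Real.hasSum_cos x)).mul_left (-2)
  have hdup := (hasSum_hypergeometric1F2Dup one_pos (by norm_num : 2 * (1 : ℝ) ≤ 3) x).mul_left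
    (x ^ 2)
  have hterm : ∀ k : ℕ, -2 * ((-1) ^ (k + 1) * x ^ (2 * (k + 1)) / ((2 * (k + 1)).factorial : ℝ)) =
      x ^ 2 * ((ascPochhammer ℝ k).eval 1 / (ascPochhammer ℝ (2 * k)).eval 3 *
        ((-x ^ 2) ^ k / (Nat.factorial k : ℝ))) := fun k => by
    have hpoch := factorial_mul_ascPochhammer ℝ 2 (2 * k)
    have hpos := ascPochhammer_pos (2 * k) (3 : ℝ) (by norm_num)
    norm_num at hpoch
    rw [ascPochhammer_eval_one, show 2 * (k + 1) = 2 + 2 * k by ring, ← hpoch, neg_pow (x ^ 2)]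
    field_simp
    ring
  rw [hdup.unique (hcos.congr_fun fun k => (hterm k).symm), Finset.sum_range_one]
  norm_num
  ring

theorem hasPowerDecay_hypergeometric1F2Dup_of_lt_one (hl : 0 < l) (hl1 : l < 1) (hr : 2 * l < r) :
    HasPowerDecay (hypergeometric1F2Dup l r) l := by
  have hbase : HasPowerDecay (hypergeometric1F2Dup l (2 * l)) l := by
    have h := (hasPowerDecay_besselSeries (a := l - 1 / 2)
      (abs_le.mpr ⟨by linarith, by linarith⟩)).const_mul (Gamma (l + 1 / 2))
    rw [sub_add_cancel] at h
    exact h.congr fun x _ => (hypergeometric1F2Dup_two_mul hl x).symm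
  simpa using hbase.hypergeometric1F2Dup_add hl le_rfl (by linarith) (sub_pos.mpr hr)

theorem hasPowerDecay_hypergeometric1F2Dup_one (hr : 3 ≤ r) :
    HasPowerDecay (hypergeometric1F2Dup 1 r) 2 := by
  have hbase : HasPowerDecay (hypergeometric1F2Dup 1 3) 2 := by
    refine ⟨4, fun x hx => ?_⟩
    rw [rpow_neg hx.le, rpow_two, ← div_eq_mul_inv, le_div_iff₀' (by positivity),
      ← abs_of_pos (by positivity : 0 < x ^ 2), ← abs_mul, sq_mul_hypergeometric1F2Dup_one_three]
    exact abs_le.mpr ⟨by linarith [cos_le_one x], by linarith [neg_one_le_cos x]⟩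
  rcases hr.eq_or_lt with rfl | hr
  · exact hbase
  · simpa using hbase.hypergeometric1F2Dup_add one_pos (by norm_num) (by norm_num)
      (sub_pos.mpr hr)

theorem exists_hasPowerDecay_hypergeometric1F2Dup (hl : 0 < l) :
    ∃ e, 2 * l - 1 < e ∧ ∀ r, 3 * l ≤ r → HasPowerDecay (hypergeometric1F2Dup l r) e := by
  obtain ⟨n, hn⟩ := exists_nat_ge l
  induction n generalizing l with
  | zero => exact absurd hn (by simpa using hl)
  | succ n ih =>
    rcases lt_trichotomy l 1 with hl1 | rfl | hl1
    · exact ⟨l, by linarith, fun r hr =>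
        hasPowerDecay_hypergeometric1F2Dup_of_lt_one hl hl1 (by linarith)⟩
    · exact ⟨2, by norm_num, fun r hr => hasPowerDecay_hypergeometric1F2Dup_one (by linarith)⟩
    · obtain ⟨e, he, h⟩ := ih (l := l - 1) (by linarith) (by push_cast at hn; linarith)
      refine ⟨e + 2, by linarith, fun r hr => ?_⟩
      have hstep := (h (r - 3) (by linarith)).hypergeometric1F2Dup_add_one (by linarith)
        (by linarith) (h (r - 3 + 1) (by linarith))
      simpa using hstep

end Hypergeometric1F2Dup

theorem integral_Ioi_mul_comp_sqrt_sq_add {r : ℝ} (hr : 0 ≤ r) (f : ℝ → ℝ) :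
    ∫ w in Ioi 0, w * f √(w ^ 2 + r ^ 2) = ∫ u in Ioi r, u * f u := by
  have himage : (fun w => √(w ^ 2 + r ^ 2)) '' Ioi 0 = Ioi r := by
    ext u
    simp only [mem_image, mem_Ioi]
    constructor
    · rintro ⟨w, hw, rfl⟩
      exact lt_sqrt_of_sq_lt (by nlinarith)
    · intro hu
      refine ⟨√(u ^ 2 - r ^ 2), sqrt_pos.mpr (by nlinarith), ?_⟩
      rw [sq_sqrt (by nlinarith), sub_add_cancel, sqrt_sq (by linarith)]
  have hderiv : ∀ w ∈ Ioi (0 : ℝ),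
      HasDerivWithinAt (fun w => √(w ^ 2 + r ^ 2)) (w / √(w ^ 2 + r ^ 2)) (Ioi 0) w := by
    intro w hw
    have hw : 0 < w := hw
    have h := (((hasDerivAt_pow 2 w).add_const (r ^ 2)).sqrt (by positivity)).hasDerivWithinAt
      (s := Ioi 0)
    simpa [mul_div_mul_left] using h
  have hinj : InjOn (fun w => √(w ^ 2 + r ^ 2)) (Ioi 0) := fun w hw v hv hwv => by
    have h := (sqrt_inj (by positivity) (by positivity)).mp hwv
    exact (pow_left_inj₀ (mem_Ioi.mp hw).le (mem_Ioi.mp hv).le two_ne_zero).mp (by linarith)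
  rw [← himage, integral_image_eq_integral_abs_deriv_smul measurableSet_Ioi hderiv hinj]
  refine setIntegral_congr_fun measurableSet_Ioi fun w (hw : 0 < w) => ?_
  have : 0 < √(w ^ 2 + r ^ 2) := sqrt_pos.mpr (by positivity)
  simp only [smul_eq_mul]
  rw [abs_of_pos (by positivity)]
  field_simp

section Wendland

variable {ν μ δ s : ℝ}

theorem generalizedWendland_zero (hμ : 0 < μ) (hδ : 0 < δ) (r : ℝ) :
    generalizedWendland 0 μ δ r = truncPow μ (1 - r / δ) := by
  rw [generalizedWendland, if_pos rfl]
  split_ifs with h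
  · rcases h.eq_or_lt with rfl | h
    · rw [div_self hδ.ne', sub_self, zero_rpow hμ.ne', truncPow_of_nonpos _ le_rfl]
    · rw [truncPow_of_pos _ (sub_pos.mpr ((div_lt_one hδ).mpr h))]
  · rw [truncPow_of_nonpos _ (sub_nonpos.mpr ((one_le_div hδ).mpr (not_le.mp h).le))]

theorem generalizedWendland_eq_integral_truncPow (hν : ν ≠ 0) (hδ : 0 < δ) {r : ℝ} (hr : 0 < r) :
    generalizedWendland ν μ δ r = ∫ u in Ioi 0, truncPow (ν - 1) (u ^ 2 - (r / δ) ^ 2) *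
      (u * truncPow μ (1 - u) / ProbabilityTheory.beta (2 * ν) (μ + 1)) := by
  have hρ : 0 < r / δ := by positivity
  have hsupport : ∀ u ∈ Ioi 0 \ Ioo (r / δ) 1, truncPow (ν - 1) (u ^ 2 - (r / δ) ^ 2) *
      (u * truncPow μ (1 - u) / ProbabilityTheory.beta (2 * ν) (μ + 1)) = 0 := by
    rintro u ⟨hu : 0 < u, hu'⟩
    rcases le_or_gt u (r / δ) with h | h
    · rw [truncPow_of_nonpos _ (by nlinarith), zero_mul]
    · rw [truncPow_of_nonpos μ (sub_nonpos.mpr (not_lt.mp fun h1 => hu' ⟨h, h1⟩)), mul_zero,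
        zero_div, mul_zero]
  rw [setIntegral_eq_of_subset_of_forall_sdiff_eq_zero measurableSet_Ioi
    (fun u hu => hρ.trans hu.1) hsupport, generalizedWendland, if_neg hν]
  split_ifs with h
  · rw [intervalIntegral.integral_of_le ((div_le_one hδ).mpr h), integral_Ioc_eq_integral_Ioo,
      ← integral_const_mul]
    refine setIntegral_congr_fun measurableSet_Ioo fun u hu => ?_
    simp only [truncPow_of_pos μ (sub_pos.mpr hu.2),
      truncPow_of_pos (ν - 1) (by nlinarith [hu.1] : 0 < u ^ 2 - (r / δ) ^ 2)]
    ring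
  · rw [Ioo_eq_empty (not_lt.mpr ((one_le_div hδ).mpr (not_le.mp h).le)), setIntegral_empty]

/-- The generalized Wendland function of support radius `1` is the integral of this kernel over
`w`; its singularity at the edge `u = r` of the domain of the defining integral has been removed by
the substitution `u = √(w² + r²)`. -/
noncomputable def wendlandKernel (ν μ r w : ℝ) : ℝ :=
  w ^ (2 * ν - 1) * truncPow μ (1 - √(w ^ 2 + r ^ 2)) / ProbabilityTheory.beta (2 * ν) (μ + 1)

theorem generalizedWendland_eq_integral_wendlandKernel (hν : ν ≠ 0) (hδ : 0 < δ) {r : ℝ}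
    (hr : 0 < r) :
    generalizedWendland ν μ δ r = ∫ w in Ioi 0, wendlandKernel ν μ (r / δ) w := by
  have hρ : 0 < r / δ := by positivity
  have hsupport : ∀ u ∈ Ioi 0 \ Ioi (r / δ), truncPow (ν - 1) (u ^ 2 - (r / δ) ^ 2) *
      (u * truncPow μ (1 - u) / ProbabilityTheory.beta (2 * ν) (μ + 1)) = 0 := by
    rintro u ⟨hu : 0 < u, hu'⟩
    rw [truncPow_of_nonpos _ (by nlinarith [notMem_Ioi.mp hu']), zero_mul]
  rw [generalizedWendland_eq_integral_truncPow hν hδ hr,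
    setIntegral_eq_of_subset_of_forall_sdiff_eq_zero measurableSet_Ioi
      (Ioi_subset_Ioi hρ.le) hsupport]
  have hfactor : ∀ u, truncPow (ν - 1) (u ^ 2 - (r / δ) ^ 2) *
      (u * truncPow μ (1 - u) / ProbabilityTheory.beta (2 * ν) (μ + 1)) =
      u * (truncPow (ν - 1) (u ^ 2 - (r / δ) ^ 2) * truncPow μ (1 - u) /
        ProbabilityTheory.beta (2 * ν) (μ + 1)) := fun u => by ring
  simp only [hfactor]
  rw [← integral_Ioi_mul_comp_sqrt_sq_add hρ.le (fun u =>
    truncPow (ν - 1) (u ^ 2 - (r / δ) ^ 2) * truncPow μ (1 - u) /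
      ProbabilityTheory.beta (2 * ν) (μ + 1))]
  refine setIntegral_congr_fun measurableSet_Ioi fun w (hw : 0 < w) => ?_
  simp only [wendlandKernel]
  rw [sq_sqrt (by positivity), add_sub_cancel_right, truncPow_of_pos (ν - 1) (by positivity),
    show 2 * ν - 1 = 1 + 2 * (ν - 1) by ring, rpow_add hw, rpow_one, rpow_mul hw.le, rpow_two]
  ring

theorem hasMoment_truncPow_sq_sub_sq (hν : 0 < ν) (hs : 0 < s) {u : ℝ} (hu : 0 < u) :
    HasMoment (fun r => truncPow (ν - 1) (u ^ 2 - r ^ 2)) s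
      (u ^ (s + 2 * ν - 2) * (ProbabilityTheory.beta (s / 2) ν / 2)) := by
  have h := ((hasMoment_truncPow_one_sub (half_pos hs) hν).comp_sq.comp_div hu).const_mul
    ((u ^ 2) ^ (ν - 1))
  have hpow : u ^ (s + 2 * ν - 2) = (u ^ 2) ^ (ν - 1) * u ^ s := by
    rw [← rpow_two, ← rpow_mul hu.le, ← rpow_add hu]; congr 1; ring
  rw [hpow, mul_assoc]
  refine h.congr fun r _ => ?_
  simp only
  rw [← truncPow_mul (by positivity)]
  congr 1
  field_simp

/-- The `s`-th moment of the generalized Wendland function of support radius `1`. -/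
noncomputable def wendlandMoment (ν μ s : ℝ) : ℝ :=
  gammaRatio ν * Gamma (2 * ν + s) * Gamma (μ + 2 * ν + 1) * Gamma (s / 2) /
    (2 * Gamma (μ + 2 * ν + s + 1) * Gamma (ν + s / 2))

theorem wendlandMoment_zero (hs : 0 < s) :
    wendlandMoment 0 μ s = ProbabilityTheory.beta s (μ + 1) := by
  have : 0 < Gamma (s / 2) := Real.Gamma_pos_of_pos (by positivity)
  rw [wendlandMoment, gammaRatio, if_pos rfl, ProbabilityTheory.beta,
    show s + (μ + 1) = μ + s + 1 by ring]
  simp only [mul_zero, add_zero, zero_add]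
  field_simp

theorem wendlandMoment_of_pos (hν : 0 < ν) (hμ : 0 < μ) (hs : 0 < s) :
    wendlandMoment ν μ s = ProbabilityTheory.beta (s / 2) ν / 2 *
      (ProbabilityTheory.beta (2 * ν + s) (μ + 1) / ProbabilityTheory.beta (2 * ν) (μ + 1)) := by
  have : 0 < Gamma (μ + 1) := Real.Gamma_pos_of_pos (by positivity)
  have : 0 < Gamma (2 * ν) := Real.Gamma_pos_of_pos (by positivity)
  have : 0 < Gamma (μ + 2 * ν + 1) := Real.Gamma_pos_of_pos (by positivity)
  have : 0 < Gamma (ν + s / 2) := Real.Gamma_pos_of_pos (by positivity)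
  have : 0 < Gamma (μ + 2 * ν + s + 1) := Real.Gamma_pos_of_pos (by positivity)
  simp only [wendlandMoment, gammaRatio, if_neg hν.ne', ProbabilityTheory.beta]
  rw [show 2 * ν + s + (μ + 1) = μ + 2 * ν + s + 1 by ring,
    show 2 * ν + (μ + 1) = μ + 2 * ν + 1 by ring, add_comm (s / 2)]
  field_simp

theorem hasMoment_generalizedWendland (hν : 0 ≤ ν) (hμ : 0 < μ) (hδ : 0 < δ)
    (hs : 0 < s) : HasMoment (generalizedWendland ν μ δ) s (δ ^ s * wendlandMoment ν μ s) := by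
  rcases hν.eq_or_lt with rfl | hν
  · rw [wendlandMoment_zero hs]
    have h := (hasMoment_truncPow_one_sub hs (by positivity : 0 < μ + 1)).comp_div hδ
    rw [add_sub_cancel_right] at h
    exact h.congr fun r _ => (generalizedWendland_zero hμ hδ r).symm
  set B := ProbabilityTheory.beta (2 * ν) (μ + 1)
  have hB0 : 0 < B := ProbabilityTheory.beta_pos (by positivity) (by positivity)
  set c := δ ^ s * (ProbabilityTheory.beta (s / 2) ν / 2) / B with hc
  obtain ⟨hint, hval⟩ := hasMoment_truncPow_one_sub (by positivity : 0 < 2 * ν + s)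
    (by positivity : 0 < μ + 1)
  rw [add_sub_cancel_right] at hint hval
  have hmix := HasMoment.integral (s := s) (m := fun u => c * (u ^ (2 * ν + s - 1) *
      truncPow μ (1 - u))) (k := fun r u => truncPow (ν - 1) (u ^ 2 - (r / δ) ^ 2) *
      (u * truncPow μ (1 - u) / B)) ?_ (fun r _ u hu => ?_) (fun u hu => ?_) (hint.const_mul c)
  · have hconst : c * ProbabilityTheory.beta (2 * ν + s) (μ + 1) =
        δ ^ s * wendlandMoment ν μ s := by
      rw [wendlandMoment_of_pos hν hμ hs, hc]; ring
    rw [integral_const_mul, hval, hconst] at hmix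
    exact hmix.congr fun r hr => (generalizedWendland_eq_integral_truncPow hν.ne' hδ hr).symm
  · exact ((measurable_truncPow _).comp (by fun_prop)).mul
      ((measurable_snd.mul ((measurable_truncPow _).comp (by fun_prop))).div_const _)
  · exact mul_nonneg (truncPow_nonneg _ _)
      (div_nonneg (mul_nonneg hu.le (truncPow_nonneg _ _)) hB0.le)
  · have h := ((hasMoment_truncPow_sq_sub_sq hν hs hu).comp_div hδ).const_mul
      (u * truncPow μ (1 - u) / B)
    have hpow : u ^ (2 * ν + s - 1) = u * u ^ (s + 2 * ν - 2) := by
      rw [show 2 * ν + s - 1 = 1 + (s + 2 * ν - 2) by ring, rpow_add hu, rpow_one]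
    have hconst : u * truncPow μ (1 - u) / B *
        (δ ^ s * (u ^ (s + 2 * ν - 2) * (ProbabilityTheory.beta (s / 2) ν / 2))) =
        c * (u ^ (2 * ν + s - 1) * truncPow μ (1 - u)) := by
      rw [hpow, hc]; ring
    exact hconst ▸ h.congr fun r _ => mul_comm _ _

theorem wendlandMoment_add_two_mul (hν : 0 ≤ ν) (hμ : 0 < μ) (hs : 0 < s) (k : ℕ) :
    wendlandMoment ν μ (s + 2 * k) = wendlandMoment ν μ s *
      (4 ^ k * (ascPochhammer ℝ k).eval (s / 2) * (ascPochhammer ℝ k).eval ((s + 1) / 2 + ν) /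
        (ascPochhammer ℝ (2 * k)).eval (2 * ((s + 1) / 2 + ν) + μ)) := by
  have h1 : Gamma (2 * ν + (s + 2 * k)) = 4 ^ k * ((ascPochhammer ℝ k).eval (ν + s / 2) *
      (ascPochhammer ℝ k).eval ((s + 1) / 2 + ν)) * Gamma (2 * ν + s) := by
    rw [show ν + s / 2 = (2 * ν + s) / 2 by ring,
      show (s + 1) / 2 + ν = (2 * ν + s + 1) / 2 by ring,
      ← ascPochhammer_eval_two_mul, ← Gamma_natCast_add (by positivity)]
    congr 1; push_cast; ring
  have h2 : Gamma (μ + 2 * ν + (s + 2 * k) + 1) =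
      (ascPochhammer ℝ (2 * k)).eval (2 * ((s + 1) / 2 + ν) + μ) *
        Gamma (μ + 2 * ν + s + 1) := by
    rw [show 2 * ((s + 1) / 2 + ν) + μ = μ + 2 * ν + s + 1 by ring,
      ← Gamma_natCast_add (by positivity)]
    congr 1; push_cast; ring
  have h3 : Gamma ((s + 2 * k) / 2) = (ascPochhammer ℝ k).eval (s / 2) * Gamma (s / 2) := by
    rw [← Gamma_natCast_add (by positivity)]; congr 1; ring
  have h4 : Gamma (ν + (s + 2 * k) / 2) =
      (ascPochhammer ℝ k).eval (ν + s / 2) * Gamma (ν + s / 2) := by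
    rw [← Gamma_natCast_add (by positivity)]; congr 1; ring
  have h5 : 0 < (ascPochhammer ℝ k).eval (ν + s / 2) := ascPochhammer_pos _ _ (by positivity)
  have : 0 < Gamma (ν + s / 2) := Real.Gamma_pos_of_pos (by positivity)
  rw [wendlandMoment, wendlandMoment, h1, h2, h3, h4]
  generalize (ascPochhammer ℝ k).eval (ν + s / 2) = p at h5 ⊢
  generalize (ascPochhammer ℝ k).eval ((s + 1) / 2 + ν) = q
  field_simp

theorem measurable_wendlandKernel (ν μ : ℝ) :
    Measurable (Function.uncurry (wendlandKernel ν μ)) := by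
  have h := (measurable_truncPow μ).comp
    (by fun_prop : Measurable fun q : ℝ × ℝ => 1 - √(q.2 ^ 2 + q.1 ^ 2))
  exact ((measurable_snd.pow_const _).mul h).div_const _

theorem wendlandKernel_nonneg (hν : 0 < ν) (hμ : 0 < μ) (r : ℝ) {w : ℝ} (hw : 0 < w) :
    0 ≤ wendlandKernel ν μ r w :=
  div_nonneg (mul_nonneg (by positivity) (truncPow_nonneg _ _))
    (ProbabilityTheory.beta_pos (by positivity) (by positivity)).le

theorem wendlandKernel_le (hν : 0 < ν) (hμ : 0 < μ) (r : ℝ) {w : ℝ} (hw : 0 < w) :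
    wendlandKernel ν μ r w ≤ wendlandKernel ν μ 0 w := by
  have hB : 0 < ProbabilityTheory.beta (2 * ν) (μ + 1) :=
    ProbabilityTheory.beta_pos (by positivity) (by positivity)
  have h : truncPow μ (1 - √(w ^ 2 + r ^ 2)) ≤ truncPow μ (1 - √(w ^ 2 + 0 ^ 2)) :=
    monotone_truncPow hμ (by gcongr 1 - √(w ^ 2 + ?_); nlinarith)
  simp only [wendlandKernel]
  gcongr

theorem integral_wendlandKernel_zero (hν : 0 < ν) (hμ : 0 < μ) :
    ∫ w in Ioi 0, wendlandKernel ν μ 0 w = 1 := by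
  have hB := ProbabilityTheory.beta_pos (by positivity : 0 < 2 * ν) (by positivity : 0 < μ + 1)
  have h := (hasMoment_truncPow_one_sub (by positivity : 0 < 2 * ν) (by positivity : 0 < μ + 1)).2
  rw [add_sub_cancel_right] at h
  rw [← div_self hB.ne', ← h, ← integral_div]
  refine setIntegral_congr_fun measurableSet_Ioi fun w (hw : 0 < w) => ?_
  simp only [wendlandKernel]
  rw [zero_pow two_ne_zero, add_zero, sqrt_sq hw.le, h]

theorem generalizedWendland_nonneg (hν : 0 ≤ ν) (hμ : 0 < μ) (hδ : 0 < δ) {r : ℝ} (hr : 0 < r) :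
    0 ≤ generalizedWendland ν μ δ r := by
  rcases hν.eq_or_lt with rfl | hν
  · exact generalizedWendland_zero hμ hδ r ▸ truncPow_nonneg _ _
  · rw [generalizedWendland_eq_integral_wendlandKernel hν.ne' hδ hr]
    exact setIntegral_nonneg measurableSet_Ioi fun w => wendlandKernel_nonneg hν hμ _

theorem isIntegrableCorrelation_generalizedWendland (hν : 0 ≤ ν) (hμ : 0 < μ) (hδ : 0 < δ)
    (hs : 0 < s) : IsIntegrableCorrelation s (generalizedWendland ν μ δ) := by
  have hint := (hasMoment_generalizedWendland hν hμ hδ hs).1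
  rcases hν.eq_or_lt with rfl | hν
  · have hcont : Continuous (generalizedWendland 0 μ δ) := by
      rw [funext (generalizedWendland_zero hμ hδ)]
      exact (continuous_truncPow hμ).comp (by fun_prop)
    have hzero : generalizedWendland 0 μ δ 0 = 1 := by
      rw [generalizedWendland_zero hμ hδ, zero_div, sub_zero, truncPow_of_pos _ one_pos, one_rpow]
    refine ⟨hcont.measurable.indicator measurableSet_Ioi, fun u hu => ?_,
      (hcont.tendsto' 0 1 hzero).mono_left nhdsWithin_le_nhds, hint⟩
    rw [abs_of_nonneg (generalizedWendland_nonneg le_rfl hμ hδ hu), ← hzero]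
    simp only [generalizedWendland_zero hμ hδ]
    exact monotone_truncPow hμ (by gcongr)
  · have h : EqOn (fun r => ∫ w in Ioi 0, wendlandKernel ν μ (r / δ) w)
        (generalizedWendland ν μ δ) (Ioi 0) :=
      fun r hr => (generalizedWendland_eq_integral_wendlandKernel hν.ne' hδ hr).symm
    refine .congr (.of_integral_kernel ?_ (fun r w => wendlandKernel_nonneg hν hμ _)
      (fun r w hw => ?_) (fun w _ => ?_) ?_ ?_) h
    · exact (measurable_wendlandKernel ν μ).comp (by fun_prop : Measurable fun q : ℝ × ℝ =>
        (q.1 / δ, q.2))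
    · exact (wendlandKernel_le hν hμ _ hw).trans_eq (by rw [zero_div])
    · have := (continuous_truncPow hμ).comp
        (by fun_prop : Continuous fun r => 1 - √(w ^ 2 + (r / δ) ^ 2))
      exact (continuous_const.mul this).div_const _
    · rw [zero_div, integral_wendlandKernel_zero hν hμ]
    · exact hint.congr_fun (fun r hr => congrArg (r ^ (s - 1) * ·) (h hr).symm) measurableSet_Ioi

theorem hankelTransform_generalizedWendland (hν : 0 ≤ ν) (hμ : 0 < μ) (hδ : 0 < δ) (hs : 0 < s)
    (z : ℝ) :
    hankelTransform s (generalizedWendland ν μ δ) z =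
      δ ^ s * wendlandMoment ν μ s / Gamma (s / 2) *
        hypergeometric1F2Dup ((s + 1) / 2 + ν) (2 * ((s + 1) / 2 + ν) + μ) (z * δ) := by
  set l := (s + 1) / 2 + ν with hl
  have hterm : ∀ (y : ℝ) (k : ℕ), y ^ k / ((Nat.factorial k : ℝ) * Gamma (k + s / 2)) *
      (δ ^ (s + 2 * k) * wendlandMoment ν μ (s + 2 * k)) =
      δ ^ s * wendlandMoment ν μ s / Gamma (s / 2) * ((ascPochhammer ℝ k).eval l /
        (ascPochhammer ℝ (2 * k)).eval (2 * l + μ) *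
          ((4 * δ ^ 2 * y) ^ k / (Nat.factorial k : ℝ))) := fun y k => by
    have h1 : 0 < (ascPochhammer ℝ k).eval (s / 2) := ascPochhammer_pos _ _ (by positivity)
    have h2 : δ ^ (s + 2 * k) = δ ^ s * (δ ^ 2) ^ k := by
      rw [rpow_add hδ, ← pow_mul, ← rpow_natCast δ (2 * k)]; push_cast; rfl
    rw [wendlandMoment_add_two_mul hν hμ hs, ← hl, Gamma_natCast_add (by positivity), h2, mul_pow,
      mul_pow]
    field_simp
  have hl0 : 0 < l := by positivity
  have hr0 : 0 < 2 * l + μ := by positivity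
  have hseries := hasSum_hypergeometric1F2Dup hl0
    (by linarith : 2 * l ≤ 2 * l + μ) (z * δ)
  have h := hasSum_hankelTransform hs (fun u => generalizedWendland_nonneg hν hμ hδ)
    (fun k => hasMoment_generalizedWendland hν hμ hδ (by positivity)) z (by
      simp only [hterm]
      refine (hseries.summable.abs.congr fun k => ?_).mul_left _
      have hnum := ascPochhammer_pos k l hl0
      have hden := ascPochhammer_pos (2 * k) (2 * l + μ) hr0
      rw [abs_mul, abs_div, abs_div, abs_pow, abs_neg, abs_of_pos hnum, abs_of_pos hden, abs_sq,
        Nat.abs_cast, show (z * δ) ^ 2 = 4 * δ ^ 2 * (z / 2) ^ 2 by ring])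
  simp only [hterm, show 4 * δ ^ 2 * -(z / 2) ^ 2 = -(z * δ) ^ 2 by ring] at h
  exact h.unique (hseries.mul_left _)

theorem generalizedWendlandSpectral_eq (ν μ δ : ℝ) {d : ℕ} (hd : 1 ≤ d) (z : ℝ) :
    generalizedWendlandSpectral d ν μ δ z =
      2 ^ (1 - (d : ℝ)) * π ^ (-(d : ℝ) / 2) * (δ ^ (d : ℝ) * wendlandMoment ν μ d /
        Gamma ((d : ℝ) / 2)) *
        hypergeometric1F2Dup (wendlandLambda d ν) (2 * wendlandLambda d ν + μ) (z * δ) := by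
  rw [generalizedWendlandSpectral, hypergeometric1F2Dup, wendlandMoment]
  have : 0 < Gamma ((d : ℝ) / 2) :=
    Real.Gamma_pos_of_pos (half_pos (Nat.cast_pos.mpr hd))
  have hpow : (2 : ℝ) ^ (1 - (d : ℝ)) = 2 * 2 ^ (-(d : ℝ)) := by
    rw [sub_eq_add_neg, rpow_add two_pos, rpow_one]
  have hb : (2 * wendlandLambda d ν + μ) / 2 = wendlandLambda d ν + μ / 2 := by ring
  have hc : (2 * wendlandLambda d ν + μ + 1) / 2 = wendlandLambda d ν + (μ + 1) / 2 := by ring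
  rw [hpow, hb, hc, rpow_natCast]
  field_simp

theorem spectralDensity_generalizedWendland (hν : 0 ≤ ν) (hμ : 0 < μ) (hδ : 0 < δ) {d : ℕ}
    (hd : 1 ≤ d) {z : ℝ} (hz : 0 < z) :
    spectralDensity d (generalizedWendland ν μ δ) z = generalizedWendlandSpectral d ν μ δ z := by
  rw [spectralDensity_eq_hankelTransform d _ hz, generalizedWendlandSpectral_eq ν μ δ hd,
    hankelTransform_generalizedWendland hν hμ hδ (mod_cast hd), ← mul_assoc]
  rfl

theorem exists_hasPowerDecay_generalizedWendlandSpectral {d : ℕ} (hd : 1 ≤ d) (hν : 0 ≤ ν)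
    (hμ : wendlandLambda d ν ≤ μ) (hδ : 0 < δ) :
    ∃ e : ℝ, d < e ∧ HasPowerDecay (generalizedWendlandSpectral d ν μ δ) e := by
  have hl : 0 < wendlandLambda d ν := by rw [wendlandLambda]; positivity
  obtain ⟨e, he, hdecay⟩ := exists_hasPowerDecay_hypergeometric1F2Dup hl
  refine ⟨e, by rw [wendlandLambda] at he; linarith, ?_⟩
  rw [funext (generalizedWendlandSpectral_eq ν μ δ hd)]
  exact ((hdecay _ (by linarith)).comp_mul_right hδ).const_mul _

end Wendland

theorem wendlandDelta_pos {ν μ β : ℝ} (hν : 0 ≤ ν) (hμ : 0 < μ) (hβ : 0 < β) :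
    0 < wendlandDelta ν μ β := by
  have : 0 < Gamma (μ + 2 * ν + 1) := Real.Gamma_pos_of_pos (by positivity)
  have : 0 < Gamma μ := Real.Gamma_pos_of_pos hμ
  rw [wendlandDelta]
  positivity

theorem lemma1_general {d : ℕ} (hd : 1 ≤ d) {ν μ δ κ β : ℝ} (hν : 0 ≤ ν)
    (hμ : wendlandLambda d ν ≤ μ) (hδ : 0 < δ) (hκ : 0 < κ) (hβ : 0 < β) :
    (∀ z : ℝ, 0 < z → spectralDensity d (generalizedWendland ν μ δ) z =
      generalizedWendlandSpectral d ν μ δ z) ∧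
    (∀ z : ℝ, 0 < z → spectralDensity d (matern κ β) z = maternSpectral d κ β z) ∧
    IntegrableOn (fun z => z ^ (d - 1) * spectralDensity d (generalizedWendland ν μ δ) z)
      (Ioi 0) ∧
    IntegrableOn (fun z => z ^ (d - 1) * spectralDensity d (matern κ β) z) (Ioi 0) ∧
    ∫ z in Ioi (0 : ℝ), z ^ (d - 1) * spectralDensity d (generalizedWendland ν μ δ) z =
      ∫ z in Ioi (0 : ℝ), z ^ (d - 1) * spectralDensity d (matern κ β) z ∧
    ∫ z in Ioi (0 : ℝ), z ^ (d - 1) * spectralDensity d (matern κ β) z =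
      Gamma ((d : ℝ) / 2) / (2 * π ^ ((d : ℝ) / 2)) := by
  have hd0 : (0 : ℝ) < d := Nat.cast_pos.mpr hd
  have hμ0 : 0 < μ := hμ.trans_lt' (by rw [wendlandLambda]; positivity)
  have hW := fun z => spectralDensity_generalizedWendland hν hμ0 hδ hd (z := z)
  have hM := fun z => spectralDensity_matern hκ hβ hd (z := z)
  obtain ⟨e, he, hWdecay⟩ := exists_hasPowerDecay_generalizedWendlandSpectral hd hν hμ hδ
  obtain ⟨hWint, hWval⟩ :=
    (isIntegrableCorrelation_generalizedWendland hν hμ0 hδ hd0).integral_pow_mul_spectralDensity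
      hd he (hWdecay.congr fun z hz => (hW z hz).symm)
  obtain ⟨hMint, hMval⟩ :=
    (isIntegrableCorrelation_matern hκ hβ hd0).integral_pow_mul_spectralDensity hd
      (lt_add_of_pos_left _ (by positivity))
      ((hasPowerDecay_maternSpectral d hκ hβ).congr fun z hz => (hM z hz).symm)
  exact ⟨hW, hM, hWint, hMint, hWval.trans hMval.symm, hMval⟩

theorem lemma1 (d : ℕ) (hd : 1 ≤ d) (ν μ β : ℝ) (hν : 0 ≤ ν) (hβ : 0 < β)
    (hμ : wendlandLambda d ν ≤ μ) :
    -- the closed forms of the two spectral densities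
    (∀ z : ℝ, 0 < z → spectralDensity d (reparamWendland ν μ β) z =
      generalizedWendlandSpectral d ν μ (wendlandDelta ν μ β) z) ∧
    (∀ z : ℝ, 0 < z → spectralDensity d (matern (ν + 1 / 2) β) z =
      maternSpectral d (ν + 1 / 2) β z) ∧
    -- both integrals converge and have the same value `Γ(d/2) / (2 π^(d/2))`
    IntegrableOn (fun z => z ^ (d - 1) * spectralDensity d (reparamWendland ν μ β) z)
      (Ioi 0) ∧
    IntegrableOn (fun z => z ^ (d - 1) * spectralDensity d (matern (ν + 1 / 2) β) z)
      (Ioi 0) ∧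
    ∫ z in Ioi (0 : ℝ), z ^ (d - 1) * spectralDensity d (reparamWendland ν μ β) z =
      ∫ z in Ioi (0 : ℝ), z ^ (d - 1) * spectralDensity d (matern (ν + 1 / 2) β) z ∧
    ∫ z in Ioi (0 : ℝ), z ^ (d - 1) * spectralDensity d (matern (ν + 1 / 2) β) z =
      Gamma ((d : ℝ) / 2) / (2 * π ^ ((d : ℝ) / 2)) := by
  have hμ0 : 0 < μ := hμ.trans_lt' (by rw [wendlandLambda]; positivity)
  exact lemma1_general hd hν hμ (wendlandDelta_pos hν hμ0 hβ) (by positivity) hβ
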